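/- **Setting.** Let \(G_{v_0}\) be a finite forest with a distinguished unweighted vertex \(v_0\) and integer weights on all other vertices, let \(G=G_{v_0}\setminus\{v_0\}\), and let \(n\in\mathbb Z\) be such that the forest \(G_{v_0}(n)\), obtained by giving \(v_0\) the weight \(n\), is negative definite (so \(G\) is negative definite as well). For a negative definite weighted forest \(H\) with vertex set \(V_H\), let \(X_H\) be the plumbed four-manifold and \(Y_H\) its boundary. \(\mathrm{Spin}^c(Y_H)\) is identified with the set of orbits of \(H_2(X_H;\mathbb Z)=\mathbb Z^{V_H}\), acting by \(K\mapsto K+x:=K+2\,\mathrm{PD}[x]\), on the set \(\mathrm{Char}(H)\) of characteristic classes \(K\in H^2(X_H;\mathbb Z)\). Put \(h_U(K)=\frac{K^2+|V_H|}{4}\); its class in \(\mathbb Q/2\mathbb Z\) depends only on the orbit \(\mathfrak t\) of \(K\) and is denoted \(\mathfrak{gr}(\mathfrak t)\). For a poset \(P\), \(\mathrm{Filt}_P\) is the category of functors \(P^{op}\to\mathrm{sSet}\). For a coset \(c\) of \(2\mathbb Z\) and \(X\in\mathrm{Filt}_c\), the shift \(X[q]\in\mathrm{Filt}_{c+q}\)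 is \(X[q]_p=X_{p-q}\). Homotopy colimits are given levelwise by the Bousfield–Kan model (the diagonal of the simplicial replacement). **Lattice space.** A cube \([K,E]\), with \(K\in\mathrm{Char}(H)\) and \(E\subseteq V_H\), has vertices \(K+\sum_{v\in I}v\) for \(I\subseteq E\), and \(h_U([K,E])\) is the minimum of \(h_U\) over its vertices. Let \(D_{H,\mathfrak t}\) be the category of cubes with \(K\in\mathfrak t\), with one morphism from each cube to each of its faces (including itself). Then \(\mathbb{CF}(H,\mathfrak t)\in\mathrm{Filt}_{\mathfrak{gr}(\mathfrak t)}\) is the homotopy colimit over \(D_{H,\mathfrak t}\) of the diagram with a single point of height \(h_U([K,E])\) at \([K,E]\). **Knot lattice space.** Regard \(v_0\) as a class in \(H_2(X_G,Y_G;\mathbb Z)\). It acts on \(\mathrm{Char}(G)\) by \(K+v_0=K+2\,\mathrm{PD}[v_0]\), hence on cubes of \(G\) by \([K,E]\mapsto[K+v_0,E]\) and on \(\mathrm{Spin}^c(Y_G)\) by \(\mathfrak t\mapsto\mathfrak t+v_0\). With \(h_V([K,E])=h_U([K+v_0,E])\), \(\mathbb{CFK}(G_{v_0},\mathfrak t)\in\mathrm{Filt}_{\mathfrak{gr}(\mathfrak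 t)\times\mathfrak{gr}(\mathfrak t+v_0)}\) is the homotopy colimit over \(D_{G,\mathfrak t}\) of the diagram of points of heights \((h_U,h_V)\). Let \(p_{1,!},p_{2,!}\) be left Kan extension along the two projections of the index poset, and let \(\Gamma^{\mathfrak t}\colon p_{2,!}\mathbb{CFK}(G_{v_0},\mathfrak t)\to p_{1,!}\mathbb{CFK}(G_{v_0},\mathfrak t+v_0)\) be induced by \([K,E]\mapsto[K+v_0,E]\). **Surgery diagram.** Let \(\Sigma_0\in H_2(X_G;\mathbb Q)\) satisfy \(\mathrm{PD}[\Sigma_0]=\mathrm{PD}[v_0]\), let \(\Sigma=v_0-\Sigma_0\in H_2(X_{G_{v_0}(n)};\mathbb Q)\), and put \(\hat A(L)=\frac{L(\Sigma)+\Sigma^2}{2}\) for \(L\in\mathrm{Char}(G_{v_0}(n))\). Sending \(L\) to \((\mathfrak t,i)=([L|_G],\hat A(L))\) identifies \(\mathrm{Spin}^c(Y_{G_{v_0}(n)})\) with the set of classes \([\mathfrak t,i]\) of such pairs under \((\mathfrak t,i)\sim(\mathfrak t+kv_0,i+k\Sigma^2)\), \(k\in\mathbb Z\). Let \(\mathcal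 I_{[\mathfrak t,i]}\) be the category with objects \((\mathfrak t',i',a)\) and \((\mathfrak t',i',b)\) for \((\mathfrak t',i')\in[\mathfrak t,i]\), and nonidentity morphisms \(\lambda_{\mathfrak t',i'}\colon(\mathfrak t',i',a)\to(\mathfrak t',i',b)\) and \(\rho_{\mathfrak t',i'}\colon(\mathfrak t',i',a)\to(\mathfrak t'+v_0,i'+\Sigma^2,b)\). Let \(g(i)=\frac{(2i-\Sigma^2)^2+\Sigma^2}{4\Sigma^2}\), let \(A_i^*\) be restriction along \(q\mapsto(q,q-2i)\), and let \(\eta_1\colon A_i^*\to p_{1,!}\) and \(\eta_2\colon A_i^*\to p_{2,!}[2i]\) be the canonical maps. For \(X=(X^{\mathfrak t},\Gamma^{\mathfrak t})_{\mathfrak t}\), the diagram \(\mathfrak{XD}^{[\mathfrak t,i]}_{\Sigma^2}(X)\colon\mathcal I_{[\mathfrak t,i]}\to\mathrm{Filt}_{\mathfrak{gr}([\mathfrak t,i])}\) is \[(\mathfrak t,i,a)\mapsto A_i^*(X^{\mathfrak t})[g(i)],\quad (\mathfrak t,i,b)\mapsto p_{1,!}(X^{\mathfrak t})[g(i)],\quad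 \lambda_{\mathfrak t,i}\mapsto\eta_1[g(i)],\quad \rho_{\mathfrak t,i}\mapsto(\Gamma^{\mathfrak t}\circ\eta_2)[g(i)],\] using \(g(i)+2i=g(i+\Sigma^2)\). Put \(\mathbb X_{\Sigma^2}(X)=\big(\operatorname{hocolim}\mathfrak{XD}^{[\mathfrak t,i]}_{\Sigma^2}(X)\big)_{[\mathfrak t,i]}\). **Pieces of the lattice space.** For \((\mathfrak t,i)\) in the class \([\mathfrak t,i]\in\mathrm{Spin}^c(Y_{G_{v_0}(n)})\), let \(\mathbb T_i(\mathfrak t)\) (respectively \(\mathbb B_i(\mathfrak t)\)) be the homotopy colimit of the diagram defining \(\mathbb{CF}(G_{v_0}(n),[\mathfrak t,i])\), restricted to the cubes \([L,E]\) with \(L|_G\in\mathfrak t\), \(\hat A(L)=i\) and \(v_0\in E\) (respectively \(v_0\notin E\)). The faces \([L,E\cup\{v_0\}]\to[L,E]\) and \([L,E\cup\{v_0\}]\to[L+v_0,E]\) induce maps \(l\colon\mathbb T_i(\mathfrak t)\to\mathbb B_i(\mathfrak t)\) and \(r\colon\mathbb T_i(\mathfrak t)\to\mathbb B_{i+\Sigma^2}(\mathfrak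 t+v_0)\). These form a diagram of shape \(\mathcal I_{[\mathfrak t,i]}\), with \(\mathbb T\) at the objects of type \(a\), \(\mathbb B\) at the objects of type \(b\), \(l\) at \(\lambda\) and \(r\) at \(\rho\). **Proposition.** For every \([\mathfrak t,i]\in\mathrm{Spin}^c(Y_{G_{v_0}(n)})\), the diagram of the pieces \(\mathbb T\), \(\mathbb B\) is naturally isomorphic, as a functor \(\mathcal I_{[\mathfrak t,i]}\to\mathrm{Filt}_{\mathfrak{gr}([\mathfrak t,i])}\), to \(\mathfrak{XD}^{[\mathfrak t,i]}_{\Sigma^2}(\mathbb{CFK}(G_{v_0}))\), where \(\mathbb{CFK}(G_{v_0})\) is taken with its flip maps \(\Gamma^{\mathfrak t}\). Moreover \(\mathbb X_{\Sigma^2}(\mathbb{CFK}(G_{v_0}))\) is isomorphic to \(\mathbb{CF}(G_{v_0}(n))\), that is, for every \([\mathfrak t,i]\) the homotopy colimit of \(\mathfrak{XD}^{[\mathfrak t,i]}_{\Sigma^2}(\mathbb{CFK}(G_{v_0}))\) is isomorphic to \(\mathbb{CF}(G_{v_0}(n),[\mathfrak t,i])\) in \(\mathrm{Filt}_{\mathfrak{gr}([\mathfrak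 t,i])}\), with absolute gradings. -/

import Mathlib

set_option linter.unusedSectionVars false

open CategoryTheory Opposite

/-- Filtered simplicial sets indexed by a poset `P`: contravariant functors from `P` to simplicial
sets. The value at `p` is the part of height at least `p`. -/
abbrev Filt (P : Type) [Preorder P] : Type 1 := Pᵒᵖ ⥤ SSet.{0}

namespace Filt

variable {P Q : Type} [Preorder P] [Preorder Q]

/-- Restriction of a filtered simplicial set along a monotone map of posets. -/
abbrev pull (f : P →o Q) : Filt Q ⥤ Filt P :=
  (Functor.whiskeringLeft _ _ _).obj f.toFunctor.op

/-- The left Kan extension of a filtered simplicial set along a monotone map of posets. -/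
noncomputable abbrev push (f : P →o Q) : Filt P ⥤ Filt Q :=
  f.toFunctor.op.lan

/-- The unit of the adjunction between left Kan extension and restriction. -/
noncomputable def pushUnit (f : P →o Q) : 𝟭 (Filt P) ⟶ push f ⋙ pull f :=
  f.toFunctor.op.lanUnit

/-- For `g ≤ f`, the structure maps `X (f p) → X (g p)` of a filtered simplicial set form a natural
transformation between the two restrictions. -/
def pullMap {f g : P →o Q} (h : ∀ p, g p ≤ f p) : pull f ⟶ pull g :=
  (Functor.whiskeringLeft _ _ _).map
    (NatTrans.op ({ app := fun p => homOfLE (h p) } : g.toFunctor ⟶ f.toFunctor))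

/-- The filtered simplicial set which is a single point of height `p`: at level `q` it is a point if
`q ≤ p`, and it is empty otherwise. -/
def point : P ⥤ Filt P where
  obj p := { obj := fun q => (Functor.const _).obj (PLift (q.unop ≤ p))
             map := fun k => (Functor.const _).map (↾fun x => ⟨k.unop.le.trans x.down⟩) }
  map k := { app := fun q => (Functor.const _).map (↾fun x => ⟨x.down.trans k.le⟩) }

end Filt

section Hocolim

variable {J : Type} [SmallCategory J]


namespace Hocolim

/-- The `n`-simplices of the homotopy colimit of `F`: a chain `j₀ ⟶ ⋯ ⟶ jₙ` in the indexing category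
together with an `n`-simplex of `F j₀`. -/
def Simplex (F : J ⥤ SSet.{0}) (n : SimplexCategoryᵒᵖ) : Type :=
  Σ x : Fin (n.unop.len + 1) ⥤ J, (F.obj (x.obj 0)).obj n

/-- The simplicial operators: restrict the chain, push the simplex forward along the part of the
chain that has been cut off at its beginning, and apply the operator to it. -/
def Simplex.act (F : J ⥤ SSet.{0}) {n m : SimplexCategoryᵒᵖ} (θ : n ⟶ m)
    (z : Simplex F n) : Simplex F m :=
  ⟨(SimplexCategory.toCat.map θ.unop).toFunctor ⋙ z.1,
    (F.obj (z.1.obj (θ.unop.toOrderHom 0))).map θ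
      ((F.map (z.1.map (homOfLE (Fin.zero_le _)))).app n z.2)⟩

lemma Simplex.act_id (F : J ⥤ SSet.{0}) {n : SimplexCategoryᵒᵖ} (z : Simplex F n) :
    Simplex.act F (𝟙 n) z = z := by
  obtain ⟨x, s⟩ := z
  refine congrArg (Sigma.mk x) ?_
  have h : F.map (x.map (homOfLE (Fin.zero_le ((𝟙 n : n ⟶ n).unop.toOrderHom 0)))) =
    𝟙 (F.obj (x.obj 0)) := (congrArg F.map (x.map_id 0)).trans (F.map_id _)
  change (F.obj (x.obj 0)).map (𝟙 n) ((F.map (x.map _)).app n s) = s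
  refine (congrArg (fun f : F.obj (x.obj 0) ⟶ F.obj (x.obj 0) =>
    (F.obj (x.obj 0)).map (𝟙 n) (f.app n s)) h).trans ?_
  simp

lemma Simplex.act_comp (F : J ⥤ SSet.{0}) {n m k : SimplexCategoryᵒᵖ} (θ : n ⟶ m) (φ : m ⟶ k)
    (z : Simplex F n) :
    Simplex.act F (θ ≫ φ) z = Simplex.act F φ (Simplex.act F θ z) := by
  obtain ⟨x, s⟩ := z
  refine congrArg (Sigma.mk ((SimplexCategory.toCat.map (θ ≫ φ).unop).toFunctor ⋙ x)) ?_
  have h : x.map (homOfLE (Fin.zero_le (θ.unop.toOrderHom 0))) ≫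
      x.map (homOfLE (θ.unop.toOrderHom.monotone (Fin.zero_le (φ.unop.toOrderHom 0)))) =
      x.map (homOfLE (Fin.zero_le (θ.unop.toOrderHom (φ.unop.toOrderHom 0)))) := by
    rw [← x.map_comp]
    rfl
  change (F.obj (x.obj (θ.unop.toOrderHom (φ.unop.toOrderHom 0)))).map (θ ≫ φ)
      ((F.map (x.map (homOfLE (Fin.zero_le (θ.unop.toOrderHom (φ.unop.toOrderHom 0)))))).app n s) =
    (F.obj (x.obj (θ.unop.toOrderHom (φ.unop.toOrderHom 0)))).map φ
      ((F.map (x.map (homOfLE (θ.unop.toOrderHom.monotone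
        (Fin.zero_le (φ.unop.toOrderHom 0)))))).app m
        ((F.obj (x.obj (θ.unop.toOrderHom 0))).map θ
          ((F.map (x.map (homOfLE (Fin.zero_le (θ.unop.toOrderHom 0))))).app n s)))
  rw [← h, F.map_comp, Functor.map_comp_apply, NatTrans.naturality_apply]
  rfl

end Hocolim

open Hocolim

/-- The homotopy colimit of a diagram of simplicial sets, in the Bousfield-Kan model: the diagonal
of the simplicial replacement `⨿_{j₀ ⟶ ⋯ ⟶ jₙ} F j₀`. -/
def SSet.hocolim (F : J ⥤ SSet.{0}) : SSet.{0} where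
  obj n := Simplex F n
  map θ := ↾(Simplex.act F θ)
  map_id n := by
    ext z
    exact Simplex.act_id F z
  map_comp θ φ := by
    ext z
    exact Simplex.act_comp F θ φ z


variable {K : Type} [SmallCategory K]

/-- Functoriality of the homotopy colimit: a functor `G` of indexing categories and a natural
transformation `F ⟶ G ⋙ F'` induce a map of homotopy colimits. -/
def SSet.hocolimMap {F : J ⥤ SSet.{0}} {F' : K ⥤ SSet.{0}} (G : J ⥤ K) (α : F ⟶ G ⋙ F') :
    SSet.hocolim F ⟶ SSet.hocolim F' where
  app n := ↾fun z : Simplex F n =>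
    (⟨z.1 ⋙ G, (α.app (z.1.obj 0)).app n z.2⟩ : Simplex F' n)
  naturality n m θ := by
    ext ⟨x, s⟩
    refine congrArg (Sigma.mk ((SimplexCategory.toCat.map θ.unop).toFunctor ⋙ x ⋙ G)) ?_
    have h := ConcreteCategory.congr_hom (NatTrans.congr_app
      (α.naturality (x.map (homOfLE (Fin.zero_le (θ.unop.toOrderHom 0))))) n) s
    have h' := NatTrans.naturality_apply (α.app (x.obj (θ.unop.toOrderHom 0))) θ
      ((F.map (x.map (homOfLE (Fin.zero_le (θ.unop.toOrderHom 0))))).app n s)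
    exact h'.trans (congrArg ((F'.obj (G.obj (x.obj (θ.unop.toOrderHom 0)))).map θ) h)

variable {P : Type} [Preorder P]

/-- The homotopy colimit of a diagram of filtered simplicial sets, computed levelwise. -/
def Filt.hocolim (F : J ⥤ Filt P) : Filt P where
  obj p := SSet.hocolim (F ⋙ (evaluation _ _).obj p)
  map k := SSet.hocolimMap (𝟭 J) (Functor.whiskerLeft F ((evaluation _ _).map k))
  map_id p := by
    ext n ⟨x, s⟩
    exact congrArg (Sigma.mk x) (ConcreteCategory.congr_hom (NatTrans.congr_app
      ((F.obj (x.obj 0)).map_id p) n) s)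
  map_comp k l := by
    ext n ⟨x, s⟩
    exact congrArg (Sigma.mk x) (ConcreteCategory.congr_hom (NatTrans.congr_app
      ((F.obj (x.obj 0)).map_comp k l) n) s)

/-- Functoriality of the homotopy colimit of filtered simplicial sets. -/
def Filt.hocolimMap {F : J ⥤ Filt P} {F' : K ⥤ Filt P} (G : J ⥤ K) (α : F ⟶ G ⋙ F') :
    Filt.hocolim F ⟶ Filt.hocolim F' where
  app p := SSet.hocolimMap G (Functor.whiskerRight α ((evaluation _ _).obj p))
  naturality p q k := by
    ext n ⟨x, s⟩
    exact congrArg (Sigma.mk (x ⋙ G)) (ConcreteCategory.congr_hom (NatTrans.congr_app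
      ((α.app (x.obj 0)).naturality k) n) s)

end Hocolim

section Height

variable {J K P Q : Type} [Preorder J] [Preorder K] [Preorder P] [Preorder Q]

/-- The diagram on a poset `J` whose value at `j` is a single point of height `h j`. -/
def heightDiagram (h : J →o P) : J ⥤ Filt P := h.toFunctor ⋙ Filt.point

/-- The homotopy colimit of the diagram of points with heights `h`. -/
def heightSpace (h : J →o P) : Filt P := Filt.hocolim (heightDiagram h)

/-- A monotone map that does not decrease heights induces a filtered map. -/
def heightMap (h : J →o P) (h' : K →o P) (φ : J →o K) (le : ∀ j, h j ≤ h' (φ j)) :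
    heightSpace h ⟶ heightSpace h' :=
  Filt.hocolimMap φ.toFunctor
    (Functor.whiskerRight ({ app := fun j => homOfLE (le j) } :
      h.toFunctor ⟶ φ.toFunctor ⋙ h'.toFunctor) Filt.point)

/-- The map over a change of poset `f` given by the identity on underlying simplicial sets. -/
def heightUnit (h : J →o P) (f : P →o Q) :
    heightSpace h ⟶ (Filt.pull f).obj (heightSpace (f.comp h)) where
  app p := SSet.hocolimMap (𝟭 J)
    { app := fun j => (Functor.const _).map (↾fun x => ⟨f.monotone x.down⟩) }


/-- Left Kan extension along `f` keeps the underlying simplicial set of `heightSpace h` and replaces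
the height function `h` by `f ∘ h`: the universal property, at each level and in each degree. -/
noncomputable def heightUnitIsColimit (h : J →o P) (f : P →o Q) (q : Qᵒᵖ) (n : SimplexCategoryᵒᵖ) :
    Limits.IsColimit (((evaluation _ (Type)).obj n).mapCocone
      ((Functor.LeftExtension.mk (L := f.toFunctor.op) (F := heightSpace h)
        (heightSpace (f.comp h)) (heightUnit h f)).coconeAt q)) where
  desc s := ↾fun z : Hocolim.Simplex (heightDiagram (f.comp h) ⋙ (evaluation _ _).obj q) n =>
    s.ι.app (CostructuredArrow.mk (Y := op (h (z.1.obj 0)))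
      (homOfLE z.2.down : q.unop ⟶ f (h (z.1.obj 0))).op)
      (⟨z.1, ⟨le_refl _⟩⟩ : Hocolim.Simplex (heightDiagram h ⋙ (evaluation _ _).obj _) n)
  fac s c := by
    ext ⟨x, ⟨y⟩⟩
    have y' : c.left.unop ≤ h (x.obj 0) := y
    let c' : CostructuredArrow f.toFunctor.op q := CostructuredArrow.mk (Y := op (h (x.obj 0)))
      (homOfLE (c.hom.unop.le.trans (f.monotone y')) : q.unop ⟶ f (h (x.obj 0))).op
    let k : c' ⟶ c := CostructuredArrow.homMk (homOfLE y').op (Subsingleton.elim _ _)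
    have w := s.w k
    exact (ConcreteCategory.congr_hom w (⟨x, ⟨le_refl _⟩⟩ :
      Hocolim.Simplex (heightDiagram h ⋙ (evaluation _ _).obj _) n)).symm
  uniq s m w := by
    ext ⟨x, ⟨y⟩⟩
    exact ConcreteCategory.congr_hom (w (CostructuredArrow.mk (Y := op (h (x.obj 0)))
      (homOfLE y : q.unop ⟶ f (h (x.obj 0))).op)) (⟨x, ⟨le_refl _⟩⟩ :
      Hocolim.Simplex (heightDiagram h ⋙ (evaluation _ _).obj _) n)

lemma heightUnit_isLeftKanExtension (h : J →o P) (f : P →o Q) :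
    (heightSpace (f.comp h)).IsLeftKanExtension (L := f.toFunctor.op) (heightUnit h f) :=
  Functor.LeftExtension.IsPointwiseLeftKanExtension.isLeftKanExtension
    (E := Functor.LeftExtension.mk (L := f.toFunctor.op) (F := heightSpace h)
        (heightSpace (f.comp h)) (heightUnit h f))
    (fun q => Limits.evaluationJointlyReflectsColimits _ (heightUnitIsColimit h f q))

/-- The comparison map from the left Kan extension of `heightSpace h` along `f` to the space with
height function `f ∘ h`. -/
noncomputable def pushComparison (h : J →o P) (f : P →o Q) :
    (Filt.push f).obj (heightSpace h) ⟶ heightSpace (f.comp h) :=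
  ((f.toFunctor.op.lanAdjunction SSet.{0}).homEquiv _ _).symm (heightUnit h f)

lemma pushComparison_isIso (h : J →o P) (f : P →o Q) : IsIso (pushComparison h f) :=
  (Functor.isIso_lanAdjunction_homEquiv_symm_iff _ _).2 (heightUnit_isLeftKanExtension h f)

/-- The left Kan extension of `heightSpace h` along `f` is the space with height function `f ∘ h`. -/
noncomputable def pushIso (h : J →o P) (f : P →o Q) :
    (Filt.push f).obj (heightSpace h) ≅ heightSpace (f.comp h) :=
  @asIso _ _ _ _ (pushComparison h f) (pushComparison_isIso h f)

end Height

noncomputable section Plumbing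

open Matrix

/-- Cosets of `2ℤ` in `ℚ`. -/
abbrev GradingCoset : Type := ℚ ⧸ AddSubgroup.zmultiples (2 : ℚ)

/-- A coset of `2ℤ` in `ℚ`, as a poset. -/
abbrev Level (c : GradingCoset) : Type := {q : ℚ // (q : GradingCoset) = c}

open Classical in
/-- The intersection form of the plumbing of a weighted graph: the adjacency matrix with the weights
on the diagonal, in the basis of `H₂` given by the vertices. -/
def intersectionForm {V : Type} (G : SimpleGraph V) (w : V → ℤ) : Matrix V V ℤ :=
  Matrix.of fun u v => if u = v then w u else if G.Adj u v then 1 else 0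

/-- An integral quadratic form is negative definite. -/
def IsNegDef {V : Type} [Fintype V] (Q : Matrix V V ℤ) : Prop :=
  ∀ x : V → ℤ, x ≠ 0 → x ⬝ᵥ Q *ᵥ x < 0

/-- A negative definite plumbing forest with integral weights. -/
structure PlumbingGraph (V : Type) [Fintype V] where
  graph : SimpleGraph V
  weight : V → ℤ
  isAcyclic : graph.IsAcyclic
  negDef : IsNegDef (intersectionForm graph weight)

namespace PlumbingGraph

variable {V : Type} [Fintype V] [DecidableEq V] (G : PlumbingGraph V)

/-- The intersection form on `H₂(X_G; ℤ) = ℤ^V`. -/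
abbrev form : Matrix V V ℤ := intersectionForm G.graph G.weight

/-- The intersection form on `H₂(X_G; ℚ) = ℚ^V`. -/
abbrev formQ : Matrix V V ℚ := G.form.map (Int.cast : ℤ → ℚ)

lemma form_transpose : G.formᵀ = G.form := by
  ext u v
  by_cases h : u = v
  · rw [h, transpose_apply]
  · simp only [form, intersectionForm, transpose_apply, of_apply, if_neg h, if_neg (Ne.symm h)]
    split_ifs with h₁ h₂ h₂
    · rfl
    · exact absurd h₁.symm h₂
    · exact absurd h₂.symm h₁
    · rfl

lemma formQ_transpose : G.formQᵀ = G.formQ := by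
  rw [formQ, ← transpose_map, form_transpose]

lemma isUnit_det_formQ : IsUnit G.formQ.det := by
  rw [isUnit_iff_ne_zero]
  intro h
  have h' : G.form.det = 0 := by
    have : ((G.form.det : ℤ) : ℚ) = 0 := by
      rw [← h]
      exact Int.cast_det _
    exact_mod_cast this
  obtain ⟨x, hx, hx'⟩ := exists_mulVec_eq_zero_iff.2 h'
  have := G.negDef x hx
  simp [hx'] at this

/-- An integral vector as a rational vector. -/
abbrev toQ (x : V → ℤ) : V → ℚ := fun v => (x v : ℚ)

lemma formQ_mulVec_toQ (x : V → ℤ) : G.formQ *ᵥ toQ x = toQ (G.form *ᵥ x) := by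
  ext v
  simp [mulVec, dotProduct, toQ]

lemma toQ_dotProduct (x y : V → ℤ) : toQ x ⬝ᵥ toQ y = ((x ⬝ᵥ y : ℤ) : ℚ) := by
  simp [dotProduct, toQ]

/-- Characteristic classes in `H²(X_G; ℤ) = Hom(H₂(X_G; ℤ), ℤ)`, recorded by their values on the
vertices. -/
def Char : Type := {K : V → ℤ // ∀ v, K v ≡ G.weight v [ZMOD 2]}

variable {G}

/-- The action `K + [S] = K + 2 PD[S]` of a class `[S] ∈ H₂(X_G, Y_G; ℤ)`, where `z v` is the
intersection number of `S` with the vertex `v`. -/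
def Char.translate (K : G.Char) (z : V → ℤ) : G.Char :=
  ⟨fun v => K.1 v + 2 * z v, fun v => by
    have := K.2 v
    simp only [Int.ModEq] at *
    omega⟩

/-- The action `K + 2 PD[x]` of a class `x ∈ H₂(X_G; ℤ)`. -/
def Char.act (K : G.Char) (x : V → ℤ) : G.Char := K.translate (G.form *ᵥ x)

lemma Char.translate_zero (K : G.Char) : K.translate 0 = K :=
  Subtype.ext (by simp [Char.translate])

lemma Char.translate_translate (K : G.Char) (y z : V → ℤ) :
    (K.translate y).translate z = K.translate (y + z) :=
  Subtype.ext (by ext v; simp [Char.translate]; ring)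

lemma Char.translate_comm (K : G.Char) (y z : V → ℤ) :
    (K.translate y).translate z = (K.translate z).translate y := by
  rw [translate_translate, translate_translate, add_comm]

lemma Char.act_act (K : G.Char) (x y : V → ℤ) : (K.act x).act y = K.act (x + y) := by
  rw [act, act, translate_translate, ← mulVec_add]
  rfl

variable (G)

/-- Two characteristic classes are equivalent if they are in the same orbit of `H₂(X_G; ℤ)`. -/
instance spincSetoid : Setoid G.Char where
  r K K' := ∃ x : V → ℤ, K' = K.act x
  iseqv :=
    { refl := fun K => ⟨0, by simp [Char.act, Char.translate_zero]⟩
      symm := by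
        rintro K _ ⟨x, rfl⟩
        exact ⟨-x, by rw [Char.act_act]; simp [Char.act, Char.translate_zero]⟩
      trans := by
        rintro K _ _ ⟨x, rfl⟩ ⟨y, rfl⟩
        exact ⟨x + y, by rw [Char.act_act]⟩ }

/-- The `Spin^c` structures on the boundary `Y_G`, as the orbits of `H₂(X_G; ℤ)` on the
characteristic classes of `X_G`. -/
def Spinc : Type := Quotient G.spincSetoid

variable {G}

/-- The `Spin^c` structure on `Y_G` obtained by restriction. -/
def Char.toSpinc (K : G.Char) : G.Spinc := Quotient.mk _ K

lemma Char.toSpinc_act (K : G.Char) (x : V → ℤ) : (K.act x).toSpinc = K.toSpinc :=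
  (Quotient.sound (s := G.spincSetoid) ⟨x, rfl⟩).symm

/-- The action of `H₂(X_G, Y_G; ℤ)`, through its boundary in `H₁(Y_G; ℤ)`, on `Spin^c` structures. -/
def Spinc.translate (t : G.Spinc) (z : V → ℤ) : G.Spinc :=
  Quotient.map' (s₁ := G.spincSetoid) (s₂ := G.spincSetoid) (fun K => K.translate z)
    (by rintro K _ ⟨x, rfl⟩; exact ⟨x, Char.translate_comm _ _ _⟩) t

lemma Char.toSpinc_translate (K : G.Char) (z : V → ℤ) :
    (K.translate z).toSpinc = K.toSpinc.translate z := rfl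

lemma Spinc.translate_translate (t : G.Spinc) (y z : V → ℤ) :
    (t.translate y).translate z = t.translate (y + z) := by
  induction t using Quotient.inductionOn with
  | h K => exact congrArg Char.toSpinc (K.translate_translate y z)

lemma Spinc.translate_zero (t : G.Spinc) : t.translate 0 = t := by
  induction t using Quotient.inductionOn with
  | h K => exact congrArg Char.toSpinc K.translate_zero

/-- The rational square `K²`. -/
noncomputable def Char.sq (K : G.Char) : ℚ := toQ K.1 ⬝ᵥ G.formQ⁻¹ *ᵥ toQ K.1

/-- The height `(K² + |V|) / 4` of a characteristic class. -/
noncomputable def Char.height (K : G.Char) : ℚ := (K.sq + Fintype.card V) / 4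

lemma dotProduct_formQ_inv_comm (x y : V → ℚ) :
    x ⬝ᵥ G.formQ⁻¹ *ᵥ y = y ⬝ᵥ G.formQ⁻¹ *ᵥ x := by
  rw [dotProduct_comm, ← vecMul_transpose, dotProduct_mulVec, transpose_nonsing_inv, formQ_transpose]

lemma toQ_translate (K : G.Char) (z : V → ℤ) :
    toQ (K.translate z).1 = toQ K.1 + (2 : ℚ) • toQ z := by
  ext v
  simp [Char.translate, toQ]

lemma Char.sq_translate (K : G.Char) (z : V → ℤ) :
    (K.translate z).sq = K.sq + 4 * (toQ K.1 ⬝ᵥ G.formQ⁻¹ *ᵥ toQ z) +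
      4 * (toQ z ⬝ᵥ G.formQ⁻¹ *ᵥ toQ z) := by
  simp only [Char.sq, toQ_translate, mulVec_add, mulVec_smul, dotProduct_add, add_dotProduct,
    smul_dotProduct, dotProduct_smul, smul_eq_mul, dotProduct_formQ_inv_comm (toQ z) (toQ K.1)]
  ring

lemma formQ_inv_mulVec (x : V → ℤ) : G.formQ⁻¹ *ᵥ toQ (G.form *ᵥ x) = toQ x := by
  rw [← formQ_mulVec_toQ, mulVec_mulVec, nonsing_inv_mul _ G.isUnit_det_formQ, one_mulVec]

lemma Char.sq_act (K : G.Char) (x : V → ℤ) :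
    (K.act x).sq = K.sq + 4 * ((K.1 ⬝ᵥ x + x ⬝ᵥ G.form *ᵥ x : ℤ) : ℚ) := by
  rw [Char.act, Char.sq_translate, formQ_inv_mulVec, toQ_dotProduct, toQ_dotProduct,
    dotProduct_comm (G.form *ᵥ x)]
  push_cast
  ring

lemma even_dotProduct_form (K : G.Char) (x : V → ℤ) :
    Even (K.1 ⬝ᵥ x + x ⬝ᵥ G.form *ᵥ x) := by
  have key : ((∑ p : V × V, if p.1 = p.2 then 0 else x p.1 * (G.form p.1 p.2 * x p.2) : ℤ) :
      ZMod 2) = 0 := by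
    rw [Int.cast_sum]
    refine Finset.sum_involution (fun p _ => p.swap) ?_ ?_ (fun _ _ => Finset.mem_univ _)
      (fun p _ => p.swap_swap)
    · rintro ⟨u, v⟩ -
      have hs : G.form v u = G.form u v := congrFun (congrFun G.form_transpose u) v
      simp only [Prod.swap, eq_comm (a := v) (b := u)]
      split_ifs with h
      · simp
      · rw [hs, show x v * (G.form u v * x u) = x u * (G.form u v * x v) by ring]
        exact CharTwo.add_self_eq_zero _
    · rintro ⟨u, v⟩ - h h'
      have : v = u := congrArg Prod.fst h'
      simp [this] at h
  rw [← ZMod.intCast_eq_zero_iff_even] at *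
  have hx : x ⬝ᵥ G.form *ᵥ x = (∑ v, x v * (G.weight v * x v)) +
      ∑ p : V × V, if p.1 = p.2 then 0 else x p.1 * (G.form p.1 p.2 * x p.2) := by
    rw [Fintype.sum_prod_type, ← Finset.sum_add_distrib]
    refine Finset.sum_congr rfl fun u _ => ?_
    rw [mulVec, dotProduct, Finset.mul_sum, ← Finset.add_sum_erase _ _ (Finset.mem_univ u),
      ← Finset.add_sum_erase _ (fun v => if u = v then 0 else _) (Finset.mem_univ u)]
    congr 1
    · simp [form, intersectionForm]
    · rw [if_pos rfl, zero_add]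
      refine Finset.sum_congr rfl fun v hv => ?_
      rw [if_neg (Finset.ne_of_mem_erase hv).symm]
  rw [hx, ← add_assoc, Int.cast_add, key, add_zero, dotProduct, ← Finset.sum_add_distrib,
    Int.cast_sum]
  refine Finset.sum_eq_zero fun v _ => ?_
  have hK : ((K.1 v : ℤ) : ZMod 2) = (G.weight v : ℤ) := (ZMod.intCast_eq_intCast_iff _ _ 2).2 (K.2 v)
  push_cast
  rw [hK]
  generalize ((G.weight v : ℤ) : ZMod 2) = a
  generalize ((x v : ℤ) : ZMod 2) = b
  revert a b
  decide

lemma Char.height_act (K : G.Char) (x : V → ℤ) :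
    ((K.act x).height : GradingCoset) = (K.height : GradingCoset) := by
  rw [eq_comm, QuotientAddGroup.eq, AddSubgroup.mem_zmultiples_iff]
  obtain ⟨m, hm⟩ := even_dotProduct_form K x
  refine ⟨m, ?_⟩
  rw [Char.height, Char.height, Char.sq_act, hm]
  push_cast
  simp
  ring

variable (G) in
/-- The coset of `2ℤ` in `ℚ` associated to a `Spin^c` structure on `Y_G`: the class of
`(c₁² - σ(X_G)) / 4` for any extension to `X_G`. -/
noncomputable def grading : G.Spinc → GradingCoset :=
  Quotient.lift (s := G.spincSetoid) (fun K => ((K.height : ℚ) : GradingCoset))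
    (by rintro K _ ⟨x, rfl⟩; exact (K.height_act x).symm)

lemma grading_toSpinc (K : G.Char) : G.grading K.toSpinc = (K.height : GradingCoset) := rfl

variable (G)

/-- A cube `[K, E]`: the convex hull of the points `K + ∑_{v ∈ I} v` with `I ⊆ E`, where adding `v`
means adding `2 PD[v]`. -/
structure Cube where
  base : G.Char
  dirs : Finset V

variable {G}

/-- The class `∑_{v ∈ I} v` in `H₂(X_G; ℤ)`. -/
def indicator (I : Finset V) : V → ℤ := fun v => if v ∈ I then 1 else 0

/-- The vertex `K + ∑_{v ∈ I} v` of the cube `[K, E]`, for `I ⊆ E`. -/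
def Cube.vertex (c : G.Cube) (I : Finset V) : G.Char := c.base.act (indicator I)

lemma indicator_union {I J : Finset V} (h : Disjoint I J) :
    indicator (I ∪ J) = indicator I + indicator J := by
  ext v
  have : v ∈ I → v ∉ J := fun h' => Finset.disjoint_left.1 h h'
  by_cases h1 : v ∈ I <;> by_cases h2 : v ∈ J <;> simp_all [indicator]

lemma Char.act_zero (K : G.Char) : K.act 0 = K := by
  simp [Char.act, Char.translate_zero]

lemma indicator_empty : indicator (∅ : Finset V) = 0 := by
  ext v; simp [indicator]

/-- The category of cubes, as a poset: there is a unique morphism `c ⟶ c'` when `c'` is a face of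
`c` (possibly `c` itself). The faces of `[K, E]` are the `[K + ∑_{v ∈ I} v, E']` with `E' ⊆ E` and
`I ⊆ E \ E'`. -/
instance : Preorder G.Cube where
  le c c' := c'.dirs ⊆ c.dirs ∧ ∃ I ⊆ c.dirs \ c'.dirs, c'.base = c.vertex I
  le_refl c := ⟨subset_rfl, ∅, by simp, by rw [Cube.vertex, indicator_empty, Char.act_zero]⟩
  le_trans c c' c'' := by
    rintro ⟨h, I, hI, e⟩ ⟨h', J, hJ, e'⟩
    have hd : Disjoint I J := by
      rw [Finset.disjoint_left]
      intro v h1 h2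
      exact (Finset.mem_sdiff.1 (hI h1)).2 (Finset.mem_sdiff.1 (hJ h2)).1
    refine ⟨h'.trans h, I ∪ J, ?_, ?_⟩
    · intro v hv
      have := @hI v
      have := @hJ v
      have := @h v
      have := @h' v
      simp only [Finset.mem_union, Finset.mem_sdiff] at *
      tauto
    · rw [e', Cube.vertex, Cube.vertex, e, Cube.vertex, Char.act_act, indicator_union hd]

/-- The height of a cube, the minimum of the heights of its vertices. -/
noncomputable def Cube.height (c : G.Cube) : ℚ :=
  c.dirs.powerset.inf' ⟨∅, Finset.empty_mem_powerset _⟩ fun I => (c.vertex I).height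

lemma Cube.height_mono {c c' : G.Cube} (h : c ≤ c') : c.height ≤ c'.height := by
  obtain ⟨h, I, hI, e⟩ := h
  refine Finset.le_inf' _ _ fun J hJ => ?_
  rw [Finset.mem_powerset] at hJ
  have hd : Disjoint I J := by
    rw [Finset.disjoint_left]
    intro v h1 h2
    exact (Finset.mem_sdiff.1 (hI h1)).2 (hJ h2)
  rw [Cube.vertex, e, Cube.vertex, Char.act_act, ← indicator_union hd]
  refine Finset.inf'_le (fun I => (c.vertex I).height) ?_
  rw [Finset.mem_powerset]
  exact Finset.union_subset (hI.trans Finset.sdiff_subset) (hJ.trans h)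

lemma Cube.coe_height (c : G.Cube) : (c.height : GradingCoset) = G.grading c.base.toSpinc := by
  obtain ⟨I, -, h⟩ := Finset.exists_mem_eq_inf' (s := c.dirs.powerset)
    ⟨∅, Finset.empty_mem_powerset _⟩ fun I => (c.vertex I).height
  rw [Cube.height, h, ← grading_toSpinc, Cube.vertex, Char.toSpinc_act]

variable (G)

/-- The part of the category of cubes that belongs to the `Spin^c` structure `t`. -/
abbrev CubeCat (t : G.Spinc) : Type := {c : G.Cube // c.base.toSpinc = t}

/-- The height function `h_U`, with values in the coset of `t`. -/
noncomputable def heightU (t : G.Spinc) : G.CubeCat t →o Level (G.grading t) where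
  toFun c := ⟨c.1.height, by rw [c.1.coe_height, c.2]⟩
  monotone' _ _ h := Cube.height_mono h

/-- The diagram with a single point of height `h_U([K, E])` at the cube `[K, E]`. -/
noncomputable def CFD (t : G.Spinc) : G.CubeCat t ⥤ Filt (Level (G.grading t)) :=
  heightDiagram (G.heightU t)

/-- The lattice space of `G`: for each `Spin^c` structure, the homotopy colimit of the diagram of
points over the category of cubes. -/
noncomputable def CF : ∀ t : G.Spinc, Filt (Level (G.grading t)) :=
  fun t => Filt.hocolim (G.CFD t)

end PlumbingGraph

section Alexander

/-- Subtraction of `q`, from the coset `c' = c + q` to the coset `c`. -/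
def Level.sub (q : ℚ) {c c' : GradingCoset} (h : c + (q : GradingCoset) = c') :
    Level c' →o Level c where
  toFun p := ⟨p.1 - q, by rw [QuotientAddGroup.mk_sub, p.2, ← h, add_sub_cancel_right]⟩
  monotone' _ _ hp := sub_le_sub_right (α := ℚ) hp q

/-- The grading shift `X[q]`, with `X[q]_p = X_{p - q}`; it adds `q` to all heights. -/
abbrev Filt.shift (q : ℚ) {c c' : GradingCoset} (h : c + (q : GradingCoset) = c') :
    Filt (Level c) ⥤ Filt (Level c') :=
  Filt.pull (Level.sub q h)

/-- The identification `X[r][q] = X[q + r]`. -/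
def Filt.shiftShift {q r q' : ℚ} (e : q + r = q') {c c' c'' : GradingCoset}
    (h : c + (r : GradingCoset) = c') (h' : c' + (q : GradingCoset) = c'')
    (h'' : c + (q' : GradingCoset) = c'') :
    Filt.shift r h ⋙ Filt.shift q h' ⟶ Filt.shift q' h'' :=
  Filt.pullMap (f := (Level.sub r h).comp (Level.sub q h')) (g := Level.sub q' h'')
    fun p => show p.1 - q' ≤ p.1 - q - r by linarith

/-- The product of two cosets, with the product order; it indexes double filtrations. -/
def BiLevel (c₁ c₂ : GradingCoset) : Type := Level c₁ × Level c₂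

instance (c₁ c₂ : GradingCoset) : PartialOrder (BiLevel c₁ c₂) :=
  inferInstanceAs (PartialOrder (Level c₁ × Level c₂))

variable {c₁ c₂ : GradingCoset}

/-- The first projection. -/
def BiLevel.fst : BiLevel c₁ c₂ →o Level c₁ := ⟨Prod.fst, fun _ _ h => h.1⟩

/-- The second projection. -/
def BiLevel.snd : BiLevel c₁ c₂ →o Level c₂ := ⟨Prod.snd, fun _ _ h => h.2⟩

/-- A pair of height functions. -/
def BiLevel.pair {J : Type} [Preorder J] (h₁ : J →o Level c₁) (h₂ : J →o Level c₂) :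
    J →o BiLevel c₁ c₂ :=
  ⟨fun j => (h₁ j, h₂ j), fun _ _ h => ⟨h₁.monotone h, h₂.monotone h⟩⟩

/-- Left Kan extension along the first projection: forget the second filtration. -/
abbrev Filt.p₁ : Filt (BiLevel c₁ c₂) ⥤ Filt (Level c₁) := Filt.push BiLevel.fst

/-- Left Kan extension along the second projection: forget the first filtration. -/
abbrev Filt.p₂ : Filt (BiLevel c₁ c₂) ⥤ Filt (Level c₂) := Filt.push BiLevel.snd

variable (i : ℚ) (h : c₂ + ((2 * i : ℚ) : GradingCoset) = c₁)

/-- The map `q ↦ (q, q - 2i)`. -/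
def alexanderHom : Level c₁ →o BiLevel c₁ c₂ :=
  BiLevel.pair OrderHom.id (Level.sub (2 * i) h)

/-- The functor `A_i^*` picking out the Alexander grading `i` part. -/
abbrev Filt.alexander : Filt (BiLevel c₁ c₂) ⥤ Filt (Level c₁) :=
  Filt.pull (alexanderHom i h)

/-- The natural transformation `A_i^* ⟶ p_{1,!}`. -/
def Filt.eta₁ : Filt.alexander i h ⟶ Filt.p₁ :=
  Functor.whiskerRight (Filt.pushUnit BiLevel.fst) (Filt.alexander i h)

/-- The natural transformation `A_i^* ⟶ p_{2,!}[2i]`. -/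
def Filt.eta₂ : Filt.alexander i h ⟶ Filt.p₂ ⋙ Filt.shift (2 * i) h :=
  Functor.whiskerRight (Filt.pushUnit BiLevel.snd) (Filt.alexander i h)

end Alexander

/-- The objects `(s, a)` and `(s, b)` of the category with the nonidentity morphisms
`λ_s : (s, a) ⟶ (s, b)` and `ρ_s : (s, a) ⟶ (σ s, b)`. -/
inductive ZigZag {S : Type} (σ : S → S) : Type
  | a (s : S) : ZigZag σ
  | b (s : S) : ZigZag σ

namespace ZigZag

variable {S : Type} {σ : S → S}

/-- The morphisms: identities, `λ_s` and `ρ_s`. -/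
inductive Hom : ZigZag σ → ZigZag σ → Type
  | id (X : ZigZag σ) : Hom X X
  | lam (s : S) : Hom (a s) (b s)
  | rho (s : S) : Hom (a s) (b (σ s))

/-- Composition; at least one of two composable morphisms is an identity. -/
def Hom.comp : {X Y Z : ZigZag σ} → Hom X Y → Hom Y Z → Hom X Z
  | _, _, _, .id _, g => g
  | _, _, _, .lam s, .id _ => .lam s
  | _, _, _, .rho s, .id _ => .rho s

instance : SmallCategory (ZigZag σ) where
  Hom := Hom
  id := Hom.id
  comp := Hom.comp
  id_comp _ := rfl
  comp_id f := by cases f <;> rfl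
  assoc f g h := by cases f <;> cases g <;> cases h <;> rfl

/-- The functor with prescribed values on the objects, on the `λ_s` and on the `ρ_s`. -/
def diagram {C : Type 1} [Category.{0} C] (A B : S → C) (l : ∀ s, A s ⟶ B s)
    (r : ∀ s, A s ⟶ B (σ s)) : ZigZag σ ⥤ C where
  obj
    | .a s => A s
    | .b s => B s
  map
    | .id _ => 𝟙 _
    | .lam s => l s
    | .rho s => r s
  map_id _ := rfl
  map_comp f g := by
    change Hom _ _ at f g
    cases f <;> cases g <;> first | exact (Category.id_comp _).symm | exact (Category.comp_id _).symm

end ZigZag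
/-- A forest with one unweighted vertex `v₀ = none` and integral weights on the other vertices
`some v`, such that the graph `G` without `v₀` is negative definite. -/
structure KnotGraph (V : Type) [Fintype V] where
  graph : SimpleGraph (Option V)
  weight : V → ℤ
  isAcyclic : graph.IsAcyclic
  negDef : IsNegDef (intersectionForm (graph.comap some) weight)

namespace KnotGraph

variable {V : Type} [Fintype V] [DecidableEq V] (Γ : KnotGraph V)

/-- The graph `G` obtained by removing `v₀`. -/
def ambient : PlumbingGraph V where
  graph := Γ.graph.comap some
  weight := Γ.weight
  isAcyclic := Γ.isAcyclic.comap (SimpleGraph.Hom.comap some Γ.graph) (Option.some_injective V)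
  negDef := Γ.negDef

open Classical in
/-- The class of `v₀` in `H₂(X_G, Y_G; ℤ)`, recorded by its intersection numbers with the vertices
of `G`. Its boundary is the knot. -/
def knotClass : V → ℤ := fun v => if Γ.graph.Adj none (some v) then 1 else 0

/-- The action `t ↦ t + [K]` of the knot on `Spin^c` structures (written `t + v₀` as well). -/
abbrev addKnot (t : Γ.ambient.Spinc) : Γ.ambient.Spinc := t.translate Γ.knotClass

/-- The action `[K, E] ↦ [K + v₀, E]` on cubes. -/
def translateCube (t : Γ.ambient.Spinc) :
    Γ.ambient.CubeCat t →o Γ.ambient.CubeCat (Γ.addKnot t) where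
  toFun c := ⟨⟨c.1.base.translate Γ.knotClass, c.1.dirs⟩, by
    rw [PlumbingGraph.Char.toSpinc_translate, c.2]⟩
  monotone' c c' := by
    rintro ⟨h, I, hI, e⟩
    refine ⟨h, I, hI, ?_⟩
    change c'.1.base.translate _ = _
    rw [e]
    exact PlumbingGraph.Char.translate_comm _ _ _

/-- The second height function `h_V([K, E]) = h_U([K + v₀, E])`. -/
def heightV (t : Γ.ambient.Spinc) :
    Γ.ambient.CubeCat t →o Level (Γ.ambient.grading (Γ.addKnot t)) :=
  (Γ.ambient.heightU (Γ.addKnot t)).comp (Γ.translateCube t)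

/-- The diagram with a single point of heights `(h_U, h_V)` at each cube. -/
def CFKD (t : Γ.ambient.Spinc) : Γ.ambient.CubeCat t ⥤
    Filt (BiLevel (Γ.ambient.grading t) (Γ.ambient.grading (Γ.addKnot t))) :=
  heightDiagram (BiLevel.pair (Γ.ambient.heightU t) (Γ.heightV t))


/-- The knot lattice space of `G_{v₀}` at the `Spin^c` structure `t`. -/
def CFKSpace (t : Γ.ambient.Spinc) :
    Filt (BiLevel (Γ.ambient.grading t) (Γ.ambient.grading (Γ.addKnot t))) :=
  Filt.hocolim (Γ.CFKD t)

/-- The flip map `p_{2,!} CFK(t) ⟶ p_{1,!} CFK(t + v₀)` induced by `[K, E] ↦ [K + v₀, E]`, where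
`p_{2,!}` and `p_{1,!}` are identified with the spaces with height functions `h_V` and `h_U`. -/
def flip (t : Γ.ambient.Spinc) :
    Filt.p₂.obj (Γ.CFKSpace t) ⟶ Filt.p₁.obj (Γ.CFKSpace (Γ.addKnot t)) :=
  (pushIso (BiLevel.pair (Γ.ambient.heightU t) (Γ.heightV t)) BiLevel.snd).hom ≫
    heightMap (Γ.heightV t) (Γ.ambient.heightU (Γ.addKnot t)) (Γ.translateCube t)
      (fun _ => le_refl _) ≫
    (pushIso (BiLevel.pair (Γ.ambient.heightU (Γ.addKnot t))
      (Γ.heightV (Γ.addKnot t))) BiLevel.fst).inv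

end KnotGraph


/-- The input of the surgery formula: doubly filtered simplicial sets for all `Spin^c` structures
`t`, with bigradings in the cosets of `t` and `t + [K]`, and filtered maps
`p_{2,!} X^t ⟶ p_{1,!} X^{t + [K]}`. Here `gr t` is the coset of `t`, and `sh t = t + [K]`. -/
structure FlipObject {T : Type} (gr : T → GradingCoset) (sh : T → T) : Type 1 where
  space : ∀ t, Filt (BiLevel (gr t) (gr (sh t)))
  flip : ∀ t, Filt.p₂.obj (space t) ⟶ Filt.p₁.obj (space (sh t))

namespace KnotGraph

variable {V : Type} [Fintype V] [DecidableEq V] (Γ : KnotGraph V)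

/-- The knot lattice space of `G_{v₀}` with its flip map. -/
def CFK : FlipObject Γ.ambient.grading Γ.addKnot where
  space := Γ.CFKSpace
  flip := Γ.flip

/-- The intersection form of `G_{v₀}(n)`, in which `v₀` has weight `n`. -/
def framedForm (n : ℤ) : Matrix (Option V) (Option V) ℤ :=
  intersectionForm Γ.graph fun v => v.elim n Γ.weight

variable (n : ℤ) (hn : IsNegDef (Γ.framedForm n))

/-- The graph `G_{v₀}(n)`. -/
def surgery : PlumbingGraph (Option V) where
  graph := Γ.graph
  weight := fun v => v.elim n Γ.weight
  isAcyclic := Γ.isAcyclic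
  negDef := hn

/-- The class `Σ₀ ∈ H₂(X_G; ℚ)` with `PD[Σ₀] = PD[v₀]`. -/
def sigma₀ : V → ℚ := Γ.ambient.formQ⁻¹ *ᵥ PlumbingGraph.toQ Γ.knotClass

/-- The class `Σ = v₀ - Σ₀ ∈ H₂(X_{G_{v₀}(n)}; ℚ)`. -/
def sigma : Option V → ℚ := fun v => v.elim 1 fun u => -Γ.sigma₀ u

/-- The self-intersection number `Σ²`. -/
def sigmaSq : ℚ := Γ.sigma ⬝ᵥ (Γ.framedForm n).map (Int.cast : ℤ → ℚ) *ᵥ Γ.sigma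

variable {Γ n hn}

/-- The restriction `L|_G` to `X_G`. -/
def restrict (L : (Γ.surgery n hn).Char) : Γ.ambient.Char :=
  ⟨fun v => L.1 (some v), fun v => L.2 (some v)⟩

/-- The value `L(Σ)`. -/
def evalSigma (L : (Γ.surgery n hn).Char) : ℚ := PlumbingGraph.toQ L.1 ⬝ᵥ Γ.sigma

/-- `Â(L) = (L(Σ) + Σ²) / 2`. -/
def alexanderHat (L : (Γ.surgery n hn).Char) : ℚ := (evalSigma L + Γ.sigmaSq n) / 2

variable (Γ n hn)

/-- The class of `v₀` in `H₂(X_{G_{v₀}(n)}; ℤ)`. -/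
def handleClass : Option V → ℤ := fun v => v.elim 1 fun _ => 0

lemma form_ambient (u v : V) :
    Γ.ambient.form u v = (Γ.surgery n hn).form (some u) (some v) := by
  by_cases h : u = v
  · simp [PlumbingGraph.form, intersectionForm, ambient, surgery, h]
  · simp only [PlumbingGraph.form, intersectionForm, ambient, surgery, h, of_apply, if_false,
      Option.some.injEq, SimpleGraph.comap_adj]
    split_ifs <;> rfl

lemma form_none_some (v : V) : (Γ.surgery n hn).form none (some v) = Γ.knotClass v := by
  by_cases h : Γ.graph.Adj none (some v) <;>
    simp [PlumbingGraph.form, intersectionForm, surgery, knotClass, h]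

lemma form_some_none (v : V) : (Γ.surgery n hn).form (some v) none = Γ.knotClass v := by
  rw [← form_none_some Γ n hn v]
  exact congrFun (congrFun (Γ.surgery n hn).form_transpose none) (some v)

lemma form_none_none : (Γ.surgery n hn).form none none = n := by
  simp [PlumbingGraph.form, intersectionForm, surgery]

lemma formQ_mulVec_sigma₀ :
    Γ.ambient.formQ *ᵥ Γ.sigma₀ = PlumbingGraph.toQ Γ.knotClass := by
  rw [sigma₀, mulVec_mulVec, mul_nonsing_inv _ Γ.ambient.isUnit_det_formQ, one_mulVec]

lemma formQ_surgery_some (y : Option V → ℚ) (v : V) :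
    ((Γ.surgery n hn).formQ *ᵥ y) (some v) =
      Γ.knotClass v * y none + (Γ.ambient.formQ *ᵥ fun u => y (some u)) v := by
  simp only [mulVec, dotProduct, Fintype.sum_option, map_apply, form_some_none, form_ambient Γ n hn]

lemma formQ_surgery_none (y : Option V → ℚ) :
    ((Γ.surgery n hn).formQ *ᵥ y) none =
      n * y none + PlumbingGraph.toQ Γ.knotClass ⬝ᵥ fun u => y (some u) := by
  simp only [mulVec, dotProduct, Fintype.sum_option, map_apply, form_none_none, form_none_some,
    PlumbingGraph.toQ]

lemma formQ_mulVec_sigma_aux :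
    (Γ.surgery n hn).formQ *ᵥ Γ.sigma = ((n : ℚ) - PlumbingGraph.toQ Γ.knotClass ⬝ᵥ Γ.sigma₀) •
      PlumbingGraph.toQ (handleClass (V := V)) := by
  have h : (fun u => Γ.sigma (some u)) = -Γ.sigma₀ := rfl
  have h' : Γ.sigma none = 1 := rfl
  funext v
  cases v with
  | none =>
    rw [formQ_surgery_none, h, h', dotProduct_neg]
    simp [PlumbingGraph.toQ, handleClass, sub_eq_add_neg]
  | some v =>
    rw [formQ_surgery_some, h, h', mulVec_neg, formQ_mulVec_sigma₀]
    simp [PlumbingGraph.toQ, handleClass]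

lemma dotProduct_handleClass (x : Option V → ℚ) :
    x ⬝ᵥ PlumbingGraph.toQ (handleClass (V := V)) = x none := by
  simp [dotProduct, Fintype.sum_option, PlumbingGraph.toQ, handleClass]

lemma sigmaSq_eq (hn : IsNegDef (Γ.framedForm n)) :
    Γ.sigmaSq n = n - PlumbingGraph.toQ Γ.knotClass ⬝ᵥ Γ.sigma₀ := by
  have h : Γ.sigmaSq n = Γ.sigma ⬝ᵥ (Γ.surgery n hn).formQ *ᵥ Γ.sigma := rfl
  rw [h, formQ_mulVec_sigma_aux, dotProduct_smul, dotProduct_handleClass]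
  simp [sigma]

lemma formQ_mulVec_sigma :
    (Γ.surgery n hn).formQ *ᵥ Γ.sigma = Γ.sigmaSq n • PlumbingGraph.toQ (handleClass (V := V)) := by
  rw [sigmaSq_eq Γ n hn, formQ_mulVec_sigma_aux]

lemma sigmaSq_ne_zero (hn : IsNegDef (Γ.framedForm n)) : Γ.sigmaSq n ≠ 0 := by
  intro h
  have h0 := formQ_mulVec_sigma Γ n hn
  rw [h, zero_smul] at h0
  have h1 : Γ.sigma = 0 := by
    rw [← one_mulVec Γ.sigma, ← nonsing_inv_mul _ (Γ.surgery n hn).isUnit_det_formQ,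
      ← mulVec_mulVec, h0, mulVec_zero]
  have h2 : (1 : ℚ) = 0 := congrFun h1 none
  exact one_ne_zero h2

variable {Γ n hn}

lemma restrict_act (L : (Γ.surgery n hn).Char) (x : Option V → ℤ) :
    restrict (L.act x) =
      ((restrict L).translate (x none • Γ.knotClass)).act fun v => x (some v) := by
  refine Subtype.ext (funext fun v => ?_)
  change L.1 (some v) + 2 * ((Γ.surgery n hn).form *ᵥ x) (some v) =
    L.1 (some v) + 2 * (x none * Γ.knotClass v) + 2 * (Γ.ambient.form *ᵥ fun v => x (some v)) v
  simp only [mulVec, dotProduct, Fintype.sum_option, form_some_none, form_ambient Γ n hn]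
  ring

lemma toSpinc_restrict_act (L : (Γ.surgery n hn).Char) (x : Option V → ℤ) :
    (restrict (L.act x)).toSpinc = (restrict L).toSpinc.translate (x none • Γ.knotClass) := by
  rw [restrict_act, PlumbingGraph.Char.toSpinc_act, PlumbingGraph.Char.toSpinc_translate]

lemma alexanderHat_act (L : (Γ.surgery n hn).Char) (x : Option V → ℤ) :
    alexanderHat (L.act x) = alexanderHat L + x none * Γ.sigmaSq n := by
  have h : evalSigma (L.act x) = evalSigma L + 2 * (x none * Γ.sigmaSq n) := by
    rw [evalSigma, PlumbingGraph.Char.act, PlumbingGraph.toQ_translate, add_dotProduct,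
      smul_dotProduct, ← PlumbingGraph.formQ_mulVec_toQ, dotProduct_comm (_ *ᵥ _),
      dotProduct_mulVec, ← mulVec_transpose, PlumbingGraph.formQ_transpose, formQ_mulVec_sigma,
      smul_dotProduct, dotProduct_comm, dotProduct_comm (PlumbingGraph.toQ (handleClass (V := V))),
      dotProduct_handleClass, evalSigma, dotProduct_comm]
    simp only [PlumbingGraph.toQ, smul_eq_mul]
    ring
  rw [alexanderHat, alexanderHat, h]
  ring

variable (Γ n hn)

/-- The set of pairs `(t, i)` with `t` a `Spin^c` structure on `Y_G` and `i = Â(k)` for a `Spin^c`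
structure `k` on the two-handle cobordism extending `t`. All such `k` are restrictions of
characteristic classes `L` of `X_{G_{v₀}(n)}`. -/
abbrev SpincPair : Type :=
  {p : Γ.ambient.Spinc × ℚ //
    ∃ L : (Γ.surgery n hn).Char, (restrict L).toSpinc = p.1 ∧ alexanderHat L = p.2}

variable {Γ n hn}

/-- The pair `(t, i) = (L|_{Y_G}, Â(L))`. -/
def phi (L : (Γ.surgery n hn).Char) : Γ.SpincPair n hn :=
  ⟨((restrict L).toSpinc, alexanderHat L), L, rfl, rfl⟩

/-- `(t, i) ↦ (t + [K], i + Σ²)`. -/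
def SpincPair.next (p : Γ.SpincPair n hn) : Γ.SpincPair n hn :=
  ⟨(Γ.addKnot p.1.1, p.1.2 + Γ.sigmaSq n), by
    obtain ⟨L, h, h'⟩ := p.2
    exact ⟨L.act handleClass, by rw [toSpinc_restrict_act, h]; simp [handleClass],
      by rw [alexanderHat_act, h']; simp [handleClass]⟩⟩

variable (Γ n hn)

/-- The relation `(t, i) ∼ (t + k[K], i + kΣ²)`, `k ∈ ℤ`. -/
instance spincPairSetoid : Setoid (Γ.SpincPair n hn) where
  r p q := ∃ k : ℤ, q.1 = (p.1.1.translate (k • Γ.knotClass), p.1.2 + k * Γ.sigmaSq n)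
  iseqv :=
    { refl := fun p => ⟨0, by simp [PlumbingGraph.Spinc.translate_zero]⟩
      symm := by
        rintro p q ⟨k, h⟩
        refine ⟨-k, ?_⟩
        rw [h]
        simp [PlumbingGraph.Spinc.translate_translate, PlumbingGraph.Spinc.translate_zero]
      trans := by
        rintro p q r ⟨k, h⟩ ⟨l, h'⟩
        refine ⟨k + l, ?_⟩
        rw [h', h, PlumbingGraph.Spinc.translate_translate, ← add_smul]
        ext
        · rfl
        · push_cast; ring }

/-- The set of classes `[t, i]`. -/
def SpincPairClass : Type := Quotient (Γ.spincPairSetoid n hn)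

variable {Γ n hn}

/-- The class `[t, i]` of `(t, i)`. -/
def SpincPair.toClass (p : Γ.SpincPair n hn) : Γ.SpincPairClass n hn := Quotient.mk _ p

lemma SpincPair.toClass_next (p : Γ.SpincPair n hn) : p.next.toClass = p.toClass :=
  (Quotient.sound (s := Γ.spincPairSetoid n hn) ⟨1, by simp [SpincPair.next]⟩).symm

lemma toClass_phi_act (L : (Γ.surgery n hn).Char) (x : Option V → ℤ) :
    (phi (L.act x)).toClass = (phi L).toClass :=
  (Quotient.sound (s := Γ.spincPairSetoid n hn) ⟨x none, by
    simp only [phi, toSpinc_restrict_act, alexanderHat_act]⟩).symm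

/-- The identification of the `Spin^c` structures on `Y_{G_{v₀}(n)}` with the classes `[t, i]`. -/
def phiSurgery : (Γ.surgery n hn).Spinc → Γ.SpincPairClass n hn :=
  Quotient.lift (s := (Γ.surgery n hn).spincSetoid) (fun L => (phi L).toClass)
    (by rintro L _ ⟨x, rfl⟩; exact (toClass_phi_act L x).symm)

variable (Γ n) in
/-- The grading shift of the two-handle cobordism, `((2i - Σ²)² + Σ²) / (4Σ²)`. -/
def gradingShift (i : ℚ) : ℚ :=
  ((2 * i - Γ.sigmaSq n) ^ 2 + Γ.sigmaSq n) / (4 * Γ.sigmaSq n)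

lemma gradingShift_add (hn : IsNegDef (Γ.framedForm n)) (i : ℚ) :
    Γ.gradingShift n i + 2 * i = Γ.gradingShift n (i + Γ.sigmaSq n) := by
  have := Γ.sigmaSq_ne_zero n hn
  rw [gradingShift, gradingShift]
  field_simp
  ring

lemma evalSigma_eq (L : (Γ.surgery n hn).Char) :
    evalSigma L = L.1 none - PlumbingGraph.toQ (restrict L).1 ⬝ᵥ Γ.sigma₀ := by
  simp only [evalSigma, dotProduct, Fintype.sum_option, sigma, PlumbingGraph.toQ, restrict,
    Option.elim]
  simp [Finset.sum_neg_distrib, sub_eq_add_neg]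

lemma sq_eq (L : (Γ.surgery n hn).Char) :
    L.sq = (restrict L).sq + evalSigma L ^ 2 / Γ.sigmaSq n := by
  have h0 := Γ.sigmaSq_ne_zero n hn
  set z : V → ℚ := Γ.ambient.formQ⁻¹ *ᵥ PlumbingGraph.toQ (restrict L).1 with hz
  set z' : Option V → ℚ := fun v => v.elim 0 z with hz'
  set y : Option V → ℚ := (evalSigma L / Γ.sigmaSq n) • Γ.sigma + z' with hy
  have key : (Γ.surgery n hn).formQ *ᵥ y = PlumbingGraph.toQ L.1 := by
    rw [hy, mulVec_add, mulVec_smul, formQ_mulVec_sigma, smul_smul, div_mul_cancel₀ _ h0]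
    funext v
    rw [Pi.add_apply]
    cases v with
    | none =>
      rw [formQ_surgery_none]
      change evalSigma L * ((1 : ℤ) : ℚ) + (n * 0 + PlumbingGraph.toQ Γ.knotClass ⬝ᵥ z) = L.1 none
      rw [hz, PlumbingGraph.dotProduct_formQ_inv_comm, ← sigma₀, evalSigma_eq]
      push_cast
      ring
    | some v =>
      rw [formQ_surgery_some]
      change evalSigma L * ((0 : ℤ) : ℚ) + (Γ.knotClass v * 0 + (Γ.ambient.formQ *ᵥ z) v) =
        L.1 (some v)
      rw [hz, mulVec_mulVec, mul_nonsing_inv _ Γ.ambient.isUnit_det_formQ, one_mulVec]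
      simp [PlumbingGraph.toQ, restrict]
  have hL : (Γ.surgery n hn).formQ⁻¹ *ᵥ PlumbingGraph.toQ L.1 = y := by
    rw [← key, mulVec_mulVec, nonsing_inv_mul _ (Γ.surgery n hn).isUnit_det_formQ, one_mulVec]
  have hzz : PlumbingGraph.toQ L.1 ⬝ᵥ z' = (restrict L).sq := by
    rw [PlumbingGraph.Char.sq, ← hz]
    simp [dotProduct, Fintype.sum_option, hz', PlumbingGraph.toQ, restrict]
  rw [PlumbingGraph.Char.sq, hL, hy, dotProduct_add, dotProduct_smul, hzz, ← evalSigma,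
    smul_eq_mul]
  ring

lemma height_eq (L : (Γ.surgery n hn).Char) :
    L.height = (restrict L).height + Γ.gradingShift n (alexanderHat L) := by
  have h0 := Γ.sigmaSq_ne_zero n hn
  rw [PlumbingGraph.Char.height, PlumbingGraph.Char.height, sq_eq, gradingShift, alexanderHat,
    Fintype.card_option]
  push_cast
  field_simp
  ring

lemma SpincPair.alexander_coset (p : Γ.SpincPair n hn) :
    Γ.ambient.grading (Γ.addKnot p.1.1) + ((2 * p.1.2 : ℚ) : GradingCoset) =
      Γ.ambient.grading p.1.1 := by
  obtain ⟨L, h, h'⟩ := p.2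
  rw [← h, ← h', addKnot, ← PlumbingGraph.Char.toSpinc_translate, PlumbingGraph.grading_toSpinc,
    PlumbingGraph.grading_toSpinc, ← QuotientAddGroup.mk_add, eq_comm, QuotientAddGroup.eq,
    AddSubgroup.mem_zmultiples_iff]
  have hL := L.2 none
  obtain ⟨m, hm⟩ : (2 : ℤ) ∣ L.1 none + n := by
    change L.1 none ≡ n [ZMOD 2] at hL
    simp only [Int.ModEq] at hL
    omega
  refine ⟨m, ?_⟩
  have hm' : (L.1 none : ℚ) + n = 2 * m := by exact_mod_cast hm
  rw [PlumbingGraph.Char.height, PlumbingGraph.Char.height, PlumbingGraph.Char.sq_translate,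
    alexanderHat, evalSigma_eq, sigmaSq_eq Γ n hn, ← sigma₀, zsmul_eq_mul]
  linear_combination -hm'

lemma SpincPair.exists_char {s : (Γ.surgery n hn).Spinc} {p : Γ.SpincPair n hn}
    (h : p.toClass = phiSurgery s) :
    ∃ L : (Γ.surgery n hn).Char, L.toSpinc = s ∧ phi L = p := by
  induction s using Quotient.inductionOn with
  | h L =>
    obtain ⟨k, hk⟩ := Quotient.exact (s := Γ.spincPairSetoid n hn) h.symm
    refine ⟨L.act (k • handleClass), PlumbingGraph.Char.toSpinc_act _ _, Subtype.ext ?_⟩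
    rw [hk]
    simp [phi, toSpinc_restrict_act, alexanderHat_act, handleClass]

lemma SpincPair.shift_coset {s : (Γ.surgery n hn).Spinc} {p : Γ.SpincPair n hn}
    (h : p.toClass = phiSurgery s) :
    Γ.ambient.grading p.1.1 + ((Γ.gradingShift n p.1.2 : ℚ) : GradingCoset) =
      (Γ.surgery n hn).grading s := by
  obtain ⟨L, rfl, rfl⟩ := SpincPair.exists_char h
  rw [PlumbingGraph.grading_toSpinc, height_eq]
  rfl

/-- Every `Spin^c` structure on `Y_{G_{v₀}(n)}` corresponds to a unique class `[t, i]`, and conversely. -/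
theorem phiSurgery_bijective :
    Function.Bijective (phiSurgery : (Γ.surgery n hn).Spinc → Γ.SpincPairClass n hn) := by
  constructor
  · intro s s' h
    induction s using Quotient.inductionOn with
    | h L =>
    obtain ⟨L', rfl, hL⟩ := SpincPair.exists_char (p := phi L) h
    have h1 : (restrict L').toSpinc = (restrict L).toSpinc := congrArg (fun p => p.1.1) hL
    have h2 : alexanderHat L' = alexanderHat L := congrArg (fun p => p.1.2) hL
    obtain ⟨x, hx⟩ := Quotient.exact (s := Γ.ambient.spincSetoid) h1
    refine (Quotient.sound (s := (Γ.surgery n hn).spincSetoid)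
      ⟨fun v => v.elim 0 x, ?_⟩ : L'.toSpinc = L.toSpinc).symm
    have h3 : restrict (L'.act fun v => v.elim 0 x) = restrict L := by
      rw [restrict_act, hx]
      simp [PlumbingGraph.Char.translate_zero]
    have h4 : alexanderHat (L'.act fun v => v.elim 0 x) = alexanderHat L := by
      rw [alexanderHat_act, h2]
      simp
    have h5 : evalSigma (L'.act fun v => v.elim 0 x) = evalSigma L := by
      rw [alexanderHat, alexanderHat] at h4
      linarith
    rw [evalSigma_eq, evalSigma_eq, h3] at h5
    refine Subtype.ext (funext fun v => ?_)
    cases v with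
    | none => exact_mod_cast (sub_left_inj.1 h5).symm
    | some v => exact (congrFun (congrArg Subtype.val h3) v).symm
  · intro c
    induction c using Quotient.inductionOn with
    | h p =>
    obtain ⟨L, h, h'⟩ := p.2
    exact ⟨L.toSpinc, congrArg (Quotient.mk (Γ.spincPairSetoid n hn))
      (Subtype.ext (Prod.ext h h'))⟩

variable (Γ n hn) (s : (Γ.surgery n hn).Spinc)

/-- The pairs `(t, i)` in the class `[t, i]` that is the `Spin^c` structure `s`. -/
abbrev Component : Type := {p : Γ.SpincPair n hn // p.toClass = phiSurgery s}

variable {Γ n hn s}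

/-- `(t, i) ↦ (t + [K], i + Σ²)` inside a class. -/
def Component.next (p : Γ.Component n hn s) : Γ.Component n hn s :=
  ⟨SpincPair.next p.1, (SpincPair.toClass_next p.1).trans p.2⟩

variable (Γ n hn s)

/-- The indexing category of the class `s = [t, i]`: objects `(t, i, a)` and `(t, i, b)`, morphisms
`λ : (t, i, a) ⟶ (t, i, b)` and `ρ : (t, i, a) ⟶ (t + [K], i + Σ², b)`. -/
abbrev SpincDiagram : Type := ZigZag (Component.next : Γ.Component n hn s → Γ.Component n hn s)

/-- The surgery diagram of `X` at `s = [t, i]`. With `g` the grading shift, its values are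
`A_i^*(X^t)[g(i)]` at `(t, i, a)` and `p_{1,!}(X^t)[g(i)]` at `(t, i, b)`; the morphism `λ` goes to
`η₁[g(i)]`, and `ρ` to `(Γ^t ∘ η₂)[g(i)]`, where `g(i) + 2i = g(i + Σ²)`. -/
def XD (X : FlipObject Γ.ambient.grading Γ.addKnot) :
    Γ.SpincDiagram n hn s ⥤ Filt (Level ((Γ.surgery n hn).grading s)) :=
  ZigZag.diagram
    (fun p => (Filt.shift (Γ.gradingShift n p.1.1.2) (SpincPair.shift_coset p.2)).obj
      ((Filt.alexander p.1.1.2 (SpincPair.alexander_coset p.1)).obj (X.space p.1.1.1)))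
    (fun p => (Filt.shift (Γ.gradingShift n p.1.1.2) (SpincPair.shift_coset p.2)).obj
      (Filt.p₁.obj (X.space p.1.1.1)))
    (fun p => (Filt.shift (Γ.gradingShift n p.1.1.2) (SpincPair.shift_coset p.2)).map
      ((Filt.eta₁ p.1.1.2 (SpincPair.alexander_coset p.1)).app (X.space p.1.1.1)))
    (fun p => (Filt.shift (Γ.gradingShift n p.1.1.2) (SpincPair.shift_coset p.2)).map
        ((Filt.eta₂ p.1.1.2 (SpincPair.alexander_coset p.1)).app (X.space p.1.1.1) ≫
          (Filt.shift (2 * p.1.1.2) (SpincPair.alexander_coset p.1)).map (X.flip p.1.1.1)) ≫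
      (Filt.shiftShift (gradingShift_add hn p.1.1.2)
        (SpincPair.alexander_coset p.1) (SpincPair.shift_coset p.2)
        (SpincPair.shift_coset (Component.next p).2)).app
          (Filt.p₁.obj (X.space (Γ.addKnot p.1.1.1))))

/-- The surgery functor applied to `X`: at every `Spin^c` structure `s` on `Y_{G_{v₀}(n)}`, the
homotopy colimit of the surgery diagram. -/
def Xb (X : FlipObject Γ.ambient.grading Γ.addKnot) :
    ∀ s : (Γ.surgery n hn).Spinc, Filt (Level ((Γ.surgery n hn).grading s)) :=
  fun s => Filt.hocolim (Γ.XD n hn s X)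

variable {Γ n hn s}

/-- The cubes `[L, E]` of `G_{v₀}(n)` in the `Spin^c` structure `s` with `v₀ ∈ E`, `L|_G ∈ t` and
`Â(L) = i`. -/
abbrev TCubes (p : Γ.Component n hn s) : Type :=
  {c : (Γ.surgery n hn).CubeCat s // none ∈ c.1.dirs ∧ phi c.1.base = p.1}

/-- The cubes `[L, E]` of `G_{v₀}(n)` in the `Spin^c` structure `s` with `v₀ ∉ E`, `L|_G ∈ t` and
`Â(L) = i`. -/
abbrev BCubes (p : Γ.Component n hn s) : Type :=
  {c : (Γ.surgery n hn).CubeCat s // none ∉ c.1.dirs ∧ phi c.1.base = p.1}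

/-- The piece `T_i(t)` of the lattice space of `G_{v₀}(n)`. -/
def TSpace (p : Γ.Component n hn s) : Filt (Level ((Γ.surgery n hn).grading s)) :=
  Filt.hocolim ((OrderHom.Subtype.val _ : TCubes p →o _).toFunctor ⋙ (Γ.surgery n hn).CFD s)

/-- The piece `B_i(t)` of the lattice space of `G_{v₀}(n)`. -/
def BSpace (p : Γ.Component n hn s) : Filt (Level ((Γ.surgery n hn).grading s)) :=
  Filt.hocolim ((OrderHom.Subtype.val _ : BCubes p →o _).toFunctor ⋙ (Γ.surgery n hn).CFD s)

lemma erase_le {c c' : (Γ.surgery n hn).Cube} (h : c ≤ c') (hc' : none ∈ c'.dirs) :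
    (⟨c.base, c.dirs.erase none⟩ : (Γ.surgery n hn).Cube) ≤ ⟨c'.base, c'.dirs.erase none⟩ := by
  obtain ⟨h, I, hI, e⟩ := h
  refine ⟨Finset.erase_subset_erase _ h, I, fun v hv => ?_, e⟩
  have h1 := Finset.mem_sdiff.1 (hI hv)
  have h2 : v ≠ none := fun h2 => h1.2 (h2 ▸ hc')
  simp [h1.1, h1.2, h2]

lemma act_le {c c' : (Γ.surgery n hn).Cube} (h : c ≤ c') (x : Option V → ℤ) :
    (⟨c.base.act x, c.dirs⟩ : (Γ.surgery n hn).Cube) ≤ ⟨c'.base.act x, c'.dirs⟩ := by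
  obtain ⟨h, I, hI, e⟩ := h
  refine ⟨h, I, hI, ?_⟩
  rw [e]
  exact PlumbingGraph.Char.translate_comm _ _ _

lemma le_erase (c : (Γ.surgery n hn).Cube) :
    c ≤ ⟨c.base, c.dirs.erase none⟩ :=
  ⟨Finset.erase_subset _ _, ∅, by simp, by
    rw [PlumbingGraph.Cube.vertex, PlumbingGraph.indicator_empty, PlumbingGraph.Char.act_zero]⟩

lemma le_act_erase {c : (Γ.surgery n hn).Cube} (hc : none ∈ c.dirs) :
    c ≤ ⟨c.base.act handleClass, c.dirs.erase none⟩ := by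
  refine ⟨Finset.erase_subset _ _, {none}, by simp [hc], ?_⟩
  have : PlumbingGraph.indicator {none} = handleClass (V := V) := by
    funext v
    cases v <;> simp [PlumbingGraph.indicator, handleClass]
  rw [PlumbingGraph.Cube.vertex, this]

/-- The face `[L, E ∪ {v₀}] ↦ [L, E]`. -/
def leftFace (p : Γ.Component n hn s) : TCubes p →o BCubes p where
  toFun c := ⟨⟨⟨c.1.1.base, c.1.1.dirs.erase none⟩, c.1.2⟩, by simp, c.2.2⟩
  monotone' _ c' h := erase_le h c'.2.1

/-- The face `[L, E ∪ {v₀}] ↦ [L + v₀, E]`. -/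
def rightFace (p : Γ.Component n hn s) : TCubes p →o BCubes p.next where
  toFun c := ⟨⟨⟨c.1.1.base.act handleClass, c.1.1.dirs.erase none⟩,
    (PlumbingGraph.Char.toSpinc_act _ _).trans c.1.2⟩, by simp, by
      have h : p.next.1 = (phi c.1.1.base).next := congrArg SpincPair.next c.2.2.symm
      rw [h]
      refine Subtype.ext ?_
      simp [phi, SpincPair.next, toSpinc_restrict_act, alexanderHat_act, handleClass]⟩
  monotone' _ c' h := act_le (erase_le h c'.2.1) handleClass

/-- The map `l : T_i(t) ⟶ B_i(t)` induced by the morphisms from cubes to their left faces. -/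
def lMap (p : Γ.Component n hn s) : TSpace p ⟶ BSpace p :=
  Filt.hocolimMap (leftFace p).toFunctor (Functor.whiskerRight
    ({ app := fun c => homOfLE (le_erase c.1.1) } :
      (OrderHom.Subtype.val _ : TCubes p →o _).toFunctor ⟶
        (leftFace p).toFunctor ⋙ (OrderHom.Subtype.val _ : BCubes p →o _).toFunctor)
    ((Γ.surgery n hn).CFD s))

/-- The map `r : T_i(t) ⟶ B_{i + Σ²}(t + [K])` induced by the morphisms from cubes to their right
faces. -/
def rMap (p : Γ.Component n hn s) : TSpace p ⟶ BSpace p.next :=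
  Filt.hocolimMap (rightFace p).toFunctor (Functor.whiskerRight
    ({ app := fun c => homOfLE (le_act_erase c.2.1) } :
      (OrderHom.Subtype.val _ : TCubes p →o _).toFunctor ⟶
        (rightFace p).toFunctor ⋙ (OrderHom.Subtype.val _ : BCubes p.next →o _).toFunctor)
    ((Γ.surgery n hn).CFD s))

variable (Γ n hn s)

/-- The diagram of the pieces `T_i(t)`, `B_i(t)` and the maps `l`, `r` in the `Spin^c` structure `s`. -/
def TB : Γ.SpincDiagram n hn s ⥤ Filt (Level ((Γ.surgery n hn).grading s)) :=
  ZigZag.diagram TSpace BSpace lMap rMap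

end KnotGraph
end Plumbing

/-!
All spaces in the statement are homotopy colimits of points over posets of cubes, so a simplex is a
chain of cubes and its filtration level is bounded by the height of the first cube of the chain. The
proof consists of comparisons of posets and of height functions.

*The pieces.* A characteristic class `L` of `G_{v₀}(n)` is determined by `L|_G` and `Â(L)`
(`char_ext`), and all pairs `(K, i)` with `K` in `t` occur (`SpincPair.exists_extension`). Therefore
`[L, E] ↦ [L|_G, E ∖ {v₀}]` identifies the cubes of `B_i(t)`, and through left faces also those of
`T_i(t)`, with the cubes of `G` in `t` (`bCubesIso`, `tCubesIso`). The vertices of a cube that lie on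
its left side have the height of their restriction to `G` plus `g(i)`, while those on its right side
have the height of their restriction plus `g(i + Σ²) = g(i) + 2i`. Hence the height is
`h_U + g(i)` on `B_i(t)` and `min (h_U, h_V + 2i) + g(i)` on `T_i(t)`
(`le_height_iff_of_notMem`, `le_height_iff_of_mem`), which are the filtrations of
`p_{1,!}(CFK^t)[g(i)]` and of `A_i^*(CFK^t)[g(i)]`. Compatibility with `λ` and `ρ` is checked after
replacing the left Kan extensions by spaces with explicit height functions, under which the unit of
the adjunction is the identity on underlying simplicial sets (`pushUnit_comp_pushIso_hom`); for `ρ`,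
restricting the right face to `G` is translation by `v₀` (`bCubesIso_rightFace`).

*The homotopy colimit.* In the Bousfield-Kan model, a simplex of the homotopy colimit of the pieces is
a chain `i₀ ⟶ ⋯ ⟶ iₘ` in the indexing category together with a chain `d₀ ≤ ⋯ ≤ dₘ` in the piece over
`i₀`. Transporting `d_k` to the piece over `i_k` gives a chain in the poset of all cubes, and this is a
bijection because transport, that is, passing to left or right faces, is an isomorphism of posets
(`leftFaceIso`, `rightFaceIso`) and the indexing category is thin; the latter holds since `Σ² ≠ 0`.
This is why the comparison with the lattice space is an isomorphism (`PosetFibration.totalIso`).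
-/

/-! ### Simplices of spaces with a height function -/

section Hocolim

variable {J K P Q : Type}

lemma CategoryTheory.Functor.ext_of_isThin {C D : Type} [SmallCategory C] [SmallCategory D]
    [Quiver.IsThin D] {F G : C ⥤ D} (h : ∀ c, F.obj c = G.obj c) : F = G :=
  Functor.ext h fun _ _ _ => Subsingleton.elim _ _

/-- A natural isomorphism of diagrams induces an isomorphism of homotopy colimits. -/
def Filt.hocolimIso [SmallCategory J] [Preorder P] {F G : J ⥤ Filt P} (e : F ≅ G) :
    Filt.hocolim F ≅ Filt.hocolim G where
  hom := Filt.hocolimMap (𝟭 J) e.hom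
  inv := Filt.hocolimMap (𝟭 J) e.inv
  hom_inv_id := by
    ext p n ⟨x, s⟩
    exact congrArg (Sigma.mk x) (ConcreteCategory.congr_hom (NatTrans.congr_app
      (NatTrans.congr_app (e.hom_inv_id_app (x.obj 0)) p) n) s)
  inv_hom_id := by
    ext p n ⟨x, s⟩
    exact congrArg (Sigma.mk x) (ConcreteCategory.congr_hom (NatTrans.congr_app
      (NatTrans.congr_app (e.inv_hom_id_app (x.obj 0)) p) n) s)

/-- A natural transformation of filtered simplicial sets which is bijective on simplices is an
isomorphism. -/
lemma Filt.isIso_of_bijective [Preorder P] {X Y : Filt P} (f : X ⟶ Y)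
    (h : ∀ p n, Function.Bijective ((f.app p).app n)) : IsIso f := by
  have : ∀ p, IsIso (f.app p) := fun p => by
    have : ∀ n, IsIso ((f.app p).app n) := fun n => (isIso_iff_bijective _).2 (h p n)
    exact NatIso.isIso_of_isIso_app _
  exact NatIso.isIso_of_isIso_app _

variable [Preorder J] [Preorder K] [Preorder P] [Preorder Q]

/-- The level `p` simplices of `heightSpace h`: chains in `J` that start at height at least `p`. -/
abbrev HeightSimplex (h : J →o P) (p : Pᵒᵖ) (n : SimplexCategoryᵒᵖ) : Type :=
  Hocolim.Simplex (heightDiagram h ⋙ (evaluation _ _).obj p) n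

/-- A simplex of `heightSpace h` is determined by its chain, since the points of a diagram of points
carry no information. -/
lemma HeightSimplex.ext {h : J →o P} {p : Pᵒᵖ} {n : SimplexCategoryᵒᵖ}
    {z w : HeightSimplex h p n} (e : ∀ k, z.1.obj k = w.1.obj k) : z = w := by
  obtain ⟨x, ⟨s⟩⟩ := z
  obtain ⟨y, ⟨t⟩⟩ := w
  obtain rfl : x = y := Functor.ext_of_isThin e
  rfl

/-- A monotone map `φ` such that `f p ≤ h' (φ j)` whenever `p ≤ h j` induces a map into the
restriction along `f`. -/
def heightPullMap (h : J →o P) (h' : K →o Q) (f : P →o Q) (φ : J →o K)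
    (le : ∀ p j, p ≤ h j → f p ≤ h' (φ j)) :
    heightSpace h ⟶ (Filt.pull f).obj (heightSpace h') where
  app p := SSet.hocolimMap φ.toFunctor
    { app := fun j => (Functor.const _).map (↾fun x => ⟨le p.unop j x.down⟩) }

/-- If `φ` is an isomorphism of posets matching the heights `h` with the restriction along `f` of the
heights `h'`, then `heightSpace h` is the restriction of `heightSpace h'` along `f`. -/
lemma isIso_heightPullMap (h : J →o P) (h' : K →o Q) (f : P →o Q) (φ : J ≃o K)
    (le : ∀ p j, p ≤ h j ↔ f p ≤ h' (φ j)) :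
    IsIso (heightPullMap h h' f ⟨φ, φ.monotone⟩ fun p j => (le p j).1) := by
  refine Filt.isIso_of_bijective _ fun p n => ⟨?_, ?_⟩
  · intro (z : HeightSimplex h p n) (w : HeightSimplex h p n) e
    exact HeightSimplex.ext fun k =>
      φ.injective (congrArg (fun u : HeightSimplex h' _ n => u.1.obj k) e)
  · rintro (w : HeightSimplex h' (op (f p.unop)) n)
    let z : HeightSimplex h p n :=
      ⟨w.1 ⋙ φ.symm.monotone.functor, ⟨(le p.unop _).2 (by
        have := w.2.down
        change f p.unop ≤ h' (φ (φ.symm (w.1.obj 0)))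
        rw [φ.apply_symm_apply]
        exact this)⟩⟩
    exact ⟨z, HeightSimplex.ext fun k => φ.apply_symm_apply _⟩

/-- The unit `X ⟶ f^* f_! X` for `X = heightSpace h`, read through the identification of
`f_! (heightSpace h)` with `heightSpace (f ∘ h)`. -/
lemma pushUnit_comp_pushIso_hom (h : J →o P) (f : P →o Q) :
    (Filt.pushUnit f).app (heightSpace h) ≫ (Filt.pull f).map (pushIso h f).hom =
      heightUnit h f :=
  ((f.toFunctor.op.lanAdjunction SSet.{0}).homEquiv_unit _ _ _).symm.trans
    (((f.toFunctor.op.lanAdjunction SSet.{0}).homEquiv _ _).apply_symm_apply _)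

end Hocolim

/-! ### Homotopy colimits of the pieces of a poset -/

section Total

variable {I J P : Type} [SmallCategory I] [Preorder J] [Preorder P]

/-- A decomposition of a poset `J` over a thin category `I` into pieces `D i`, with transport along
morphisms of `I` an isomorphism of posets, in such a way that `J` is the Grothendieck construction of
`D`: a relation `c ≤ c'` holds in `J` exactly if, for some morphism from the index of `c` to that of
`c'`, the transport of `c` is at most `c'`. Thinness of `I` is left to an instance argument. -/
structure PosetFibration (I J : Type) [SmallCategory I] [Preorder J] where
  /-- The piece over an object of the base. -/
  D : I → Type
  [preorder : ∀ i, Preorder (D i)]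
  /-- Transport along a morphism of the base. -/
  tr : ∀ {i j : I}, (i ⟶ j) → (D i ≃o D j)
  tr_id : ∀ {i : I} (d : D i), tr (𝟙 i) d = d
  tr_comp : ∀ {i j k : I} (f : i ⟶ j) (g : j ⟶ k) (d : D i), tr (f ≫ g) d = tr g (tr f d)
  /-- The inclusion of a piece. -/
  ι : ∀ i, D i →o J
  ι_injective : ∀ i, Function.Injective (ι i)
  exists_ι_eq : ∀ c, ∃ i d, ι i d = c
  index_eq : ∀ {i j : I} {d : D i} {d' : D j}, ι i d = ι j d' → i = j
  le_tr : ∀ {i j : I} (f : i ⟶ j) (d : D i), ι i d ≤ ι j (tr f d)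
  exists_tr_le : ∀ {i j : I} {d : D i} {d' : D j}, ι i d ≤ ι j d' → ∃ f : i ⟶ j, tr f d ≤ d'

namespace PosetFibration

attribute [instance] PosetFibration.preorder

variable (T : PosetFibration I J) (h : J →o P)

/-- The diagram of the pieces of `heightSpace h`. -/
def pieces : I ⥤ Filt P where
  obj i := heightSpace (h.comp (T.ι i))
  map {i j} f := heightMap _ _ ⟨T.tr f, (T.tr f).monotone⟩ fun d => h.monotone (T.le_tr f d)
  map_id i := by
    ext p n z
    exact HeightSimplex.ext (h := h.comp (T.ι i)) fun k => T.tr_id _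
  map_comp {i j l} f g := by
    ext p n z
    exact HeightSimplex.ext (h := h.comp (T.ι l)) fun k => T.tr_comp _ _ _

variable {T h}

variable (T) in
/-- The index of the piece in which an element of `J` lies. -/
noncomputable def index (c : J) : I := (T.exists_ι_eq c).choose

variable (T) in
/-- An element of `J`, as an element of its piece. -/
noncomputable def lift (c : J) : T.D (T.index c) := (T.exists_ι_eq c).choose_spec.choose

lemma ι_lift (c : J) : T.ι _ (T.lift c) = c := (T.exists_ι_eq c).choose_spec.choose_spec

lemma index_ι (i : I) (d : T.D i) : T.index (T.ι i d) = i := T.index_eq (T.ι_lift _)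

lemma exists_tr_lift_le {c c' : J} (h : c ≤ c') :
    ∃ f : T.index c ⟶ T.index c', T.tr f (T.lift c) ≤ T.lift c' :=
  T.exists_tr_le (by rwa [ι_lift, ι_lift])

variable (T) in
/-- The projection to the base. -/
noncomputable def proj [Quiver.IsThin I] : J ⥤ I where
  obj := T.index
  map f := (T.exists_tr_lift_le f.le).choose
  map_id _ := Subsingleton.elim _ _
  map_comp _ _ := Subsingleton.elim _ _

/-- The simplices of the homotopy colimit of the pieces: a chain in the base, and a chain in the
piece over its first element. -/
abbrev Simplex (T : PosetFibration I J) (h : J →o P) (p : Pᵒᵖ) (n : SimplexCategoryᵒᵖ) : Type :=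
  Hocolim.Simplex (T.pieces h ⋙ (evaluation _ _).obj p) n

/-- The chain in the piece over the first element of the chain in the base. -/
def Simplex.fiber {p : Pᵒᵖ} {n : SimplexCategoryᵒᵖ} (z : T.Simplex h p n) :
    HeightSimplex (h.comp (T.ι (z.1.obj 0))) p n := z.2

/-- The chain in `J` obtained by transporting the `k`-th element of the chain in the fibre to the
piece over the `k`-th element of the chain in the base. -/
def Simplex.total {p : Pᵒᵖ} {n : SimplexCategoryᵒᵖ} (z : T.Simplex h p n) :
    HeightSimplex h p n :=
  ⟨Monotone.functor (f := fun k =>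
      T.ι _ (T.tr (z.1.map (homOfLE (Fin.zero_le k))) (z.fiber.1.obj k))) (by
    intro k l hkl
    have e : z.1.map (homOfLE (Fin.zero_le l)) =
        z.1.map (homOfLE (Fin.zero_le k)) ≫ z.1.map (homOfLE hkl) := by
      rw [← z.1.map_comp]; rfl
    refine (T.le_tr (z.1.map (homOfLE hkl)) _).trans ((T.ι _).monotone ?_)
    rw [e, T.tr_comp]
    exact (T.tr _).monotone ((T.tr _).monotone (z.fiber.1.map (homOfLE hkl)).le)),
  ⟨z.fiber.2.down.trans (h.monotone (T.le_tr _ _))⟩⟩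

variable (T h)

/-- The comparison map from the homotopy colimit of the pieces to `heightSpace h`. -/
def totalMap : Filt.hocolim (T.pieces h) ⟶ heightSpace h where
  app p :=
    { app := fun n => ↾fun z : T.Simplex h p n => z.total
      naturality := fun n m θ => by
        ext z
        refine HeightSimplex.ext (h := h) fun k => ?_
        refine congrArg (T.ι _) ((T.tr_comp _ _ _).symm.trans ?_)
        exact congrArg (fun f => T.tr f _) (z.1.map_comp _ _).symm }
  naturality p q f := by
    ext n z
    exact HeightSimplex.ext (h := h) fun k => rfl

variable {T h}

lemma Simplex.base_eq {p : Pᵒᵖ} {n : SimplexCategoryᵒᵖ} [Quiver.IsThin I] (z : T.Simplex h p n) :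
    z.1 = z.total.1 ⋙ T.proj :=
  Functor.ext_of_isThin fun _ => (T.index_ι _ _).symm

/-- The chain in `J` determines the chain in `I` by projection, and then the chain in the fibre because
transport is injective. -/
lemma Simplex.total_injective [Quiver.IsThin I] (p : Pᵒᵖ) (n : SimplexCategoryᵒᵖ) :
    Function.Injective (Simplex.total : T.Simplex h p n → HeightSimplex h p n) := by
  intro z w e
  have hb : z.1 = w.1 := by rw [z.base_eq, w.base_eq, e]
  obtain ⟨x, y⟩ := z
  obtain ⟨x', y'⟩ := w
  obtain rfl : x = x' := hb
  refine congrArg (Sigma.mk x) (HeightSimplex.ext (h := h.comp (T.ι (x.obj 0))) fun k => ?_)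
  exact (T.tr _).injective (T.ι_injective _ (congrArg (fun u : HeightSimplex h p n => u.1.obj k) e))

lemma tr_map_zero_id {m : ℕ} (x : Fin (m + 1) ⥤ I) (d : T.D (x.obj 0)) :
    T.tr (x.map (homOfLE (Fin.zero_le 0))) d = d :=
  (congrArg (fun f => T.tr f d) (x.map_id 0)).trans (T.tr_id d)

/-- Every chain in `J` arises from the projected chain in `I` and the chain obtained by transporting
all elements back to the piece of the first one. -/
lemma exists_total_chain_eq [Quiver.IsThin I] {m : ℕ} (w : Fin (m + 1) ⥤ J) :
    ∃ (x : Fin (m + 1) ⥤ I) (y : Fin (m + 1) ⥤ T.D (x.obj 0)),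
      ∀ k, T.ι _ (T.tr (x.map (homOfLE (Fin.zero_le k))) (y.obj k)) = w.obj k := by
  let x : Fin (m + 1) ⥤ I := w ⋙ T.proj
  let y : Fin (m + 1) → T.D (x.obj 0) := fun k =>
    (T.tr (x.map (homOfLE (Fin.zero_le k)))).symm (T.lift (w.obj k))
  have tr_y : ∀ k, T.tr (x.map (homOfLE (Fin.zero_le k))) (y k) = T.lift (w.obj k) :=
    fun k => OrderIso.apply_symm_apply _ _
  have hy : Monotone y := by
    intro k l hkl
    have e : x.map (homOfLE (Fin.zero_le l)) =
        x.map (homOfLE (Fin.zero_le k)) ≫ x.map (homOfLE hkl) := Subsingleton.elim _ _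
    refine (T.tr (x.map (homOfLE (Fin.zero_le l)))).le_iff_le.1 ?_
    rw [tr_y l, e, T.tr_comp, tr_y k]
    exact (T.exists_tr_lift_le (w.map (homOfLE hkl)).le).choose_spec
  exact ⟨x, hy.functor, fun k => (congrArg (T.ι _) (tr_y k)).trans (T.ι_lift _)⟩

lemma Simplex.total_surjective [Quiver.IsThin I] (p : Pᵒᵖ) (n : SimplexCategoryᵒᵖ) :
    Function.Surjective (Simplex.total : T.Simplex h p n → HeightSimplex h p n) := by
  rintro ⟨w, ⟨hw⟩⟩
  obtain ⟨x, y, hy⟩ := T.exists_total_chain_eq w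
  have hy0 : T.ι _ (y.obj 0) = w.obj 0 := by
    rw [← hy 0, tr_map_zero_id]
  let v : HeightSimplex (h.comp (T.ι (x.obj 0))) p n :=
    ⟨y, ⟨show p.unop ≤ h (T.ι _ (y.obj 0)) from hy0 ▸ hw⟩⟩
  exact ⟨⟨x, v⟩, HeightSimplex.ext hy⟩

variable (T h)

/-- The space `heightSpace h` is the homotopy colimit of its pieces, up to isomorphism and not only up
to weak equivalence, because transport along morphisms of the base is invertible. -/
noncomputable def totalIso [Quiver.IsThin I] : Filt.hocolim (T.pieces h) ≅ heightSpace h :=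
  @asIso _ _ _ _ (T.totalMap h) (Filt.isIso_of_bijective _ fun p n =>
    ⟨Simplex.total_injective p n, Simplex.total_surjective p n⟩)

end PosetFibration

end Total

/-! ### The indexing category of the surgery diagram -/

namespace ZigZag

variable {S : Type} {σ : S → S}

lemma Hom.eq_lam_or_rho {s t : S} (f : Hom (σ := σ) (a s) (b t)) :
    t = s ∧ f ≍ (Hom.lam s : Hom (σ := σ) _ _) ∨ t = σ s ∧ f ≍ (Hom.rho s : Hom (σ := σ) _ _) := by
  cases f with
  | lam => exact .inl ⟨rfl, .rfl⟩
  | rho => exact .inr ⟨rfl, .rfl⟩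

/-- The morphisms `λ_s` and `ρ_s` are parallel only if `σ s = s`. -/
lemma isThin (h : ∀ s, σ s ≠ s) : Quiver.IsThin (ZigZag σ) := by
  refine fun X Y => ⟨fun f g => ?_⟩
  change Hom _ _ at f g
  cases X with
  | a s =>
    cases Y with
    | a t => cases f; cases g; rfl
    | b t =>
      rcases f.eq_lam_or_rho with ⟨e, hf⟩ | ⟨e, hf⟩ <;>
        rcases g.eq_lam_or_rho with ⟨e', hg⟩ | ⟨e', hg⟩
      · exact eq_of_heq (hf.trans hg.symm)
      · exact absurd (e'.symm.trans e) (h s)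
      · exact absurd (e.symm.trans e') (h s)
      · exact eq_of_heq (hf.trans hg.symm)
  | b s =>
    cases Y with
    | a t => cases f
    | b t => cases f; cases g; rfl

variable {C : Type 1} [Category.{0} C]

/-- A natural isomorphism of diagrams of shape `ZigZag σ` is checked on the `λ_s` and `ρ_s`. -/
def diagramIso {A B A' B' : S → C} {l : ∀ s, A s ⟶ B s} {r : ∀ s, A s ⟶ B (σ s)}
    {l' : ∀ s, A' s ⟶ B' s} {r' : ∀ s, A' s ⟶ B' (σ s)} (α : ∀ s, A s ≅ A' s)
    (β : ∀ s, B s ≅ B' s) (hl : ∀ s, l s ≫ (β s).hom = (α s).hom ≫ l' s)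
    (hr : ∀ s, r s ≫ (β (σ s)).hom = (α s).hom ≫ r' s) :
    diagram A B l r ≅ diagram A' B' l' r' :=
  NatIso.ofComponents (fun | .a s => α s | .b s => β s) (by
    intro X Y f
    change Hom _ _ at f
    cases f with
    | id X => exact (Category.id_comp _).trans (Category.comp_id _).symm
    | lam s => exact hl s
    | rho s => exact hr s)

end ZigZag

/-! ### Cubes of the surgery and cubes of the ambient graph -/

noncomputable section Plumbing

open Matrix

namespace PlumbingGraph

variable {V : Type} [Fintype V] [DecidableEq V] {G : PlumbingGraph V}

lemma Cube.ext {c c' : G.Cube} (h : c.base = c'.base) (h' : c.dirs = c'.dirs) : c = c' := by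
  cases c; cases c'; cases h; cases h'; rfl

lemma Cube.le_height_iff {c : G.Cube} {q : ℚ} :
    q ≤ c.height ↔ ∀ I ⊆ c.dirs, q ≤ (c.vertex I).height := by
  exact (Finset.le_inf'_iff _ _).trans (by simp only [Finset.mem_powerset])

end PlumbingGraph

namespace KnotGraph

variable {V : Type} [Fintype V] [DecidableEq V] {Γ : KnotGraph V} {n : ℤ}
  {hn : IsNegDef (Γ.framedForm n)} {s : (Γ.surgery n hn).Spinc}

/-- A characteristic class of `G_{v₀}(n)` is determined by its restriction to `G` and by `Â`. -/
lemma char_ext {L L' : (Γ.surgery n hn).Char} (h : restrict L = restrict L')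
    (h' : alexanderHat L = alexanderHat L') : L = L' := by
  have h1 : evalSigma L = evalSigma L' := by
    rw [alexanderHat, alexanderHat] at h'
    linarith
  rw [evalSigma_eq, evalSigma_eq, h] at h1
  refine Subtype.ext (funext fun v => ?_)
  cases v with
  | none => exact_mod_cast sub_left_inj.1 h1
  | some v => exact congrFun (congrArg Subtype.val h) v

lemma restrict_act_of_none_eq_zero (L : (Γ.surgery n hn).Char) {x : Option V → ℤ}
    (hx : x none = 0) : restrict (L.act x) = (restrict L).act fun v => x (some v) := by
  rw [restrict_act, hx, zero_smul, PlumbingGraph.Char.translate_zero]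

lemma phi_act_of_none_eq_zero (L : (Γ.surgery n hn).Char) {x : Option V → ℤ}
    (hx : x none = 0) : phi (L.act x) = phi L := by
  simp [phi, toSpinc_restrict_act, alexanderHat_act, hx, PlumbingGraph.Spinc.translate_zero]

lemma phi_act_of_none_eq_one (L : (Γ.surgery n hn).Char) {x : Option V → ℤ}
    (hx : x none = 1) : phi (L.act x) = (phi L).next := by
  simp [phi, SpincPair.next, toSpinc_restrict_act, alexanderHat_act, hx]

lemma SpincPair.next_injective : Function.Injective (SpincPair.next : Γ.SpincPair n hn → _) := by
  intro p q h
  have h1 : p.1.1.translate Γ.knotClass = q.1.1.translate Γ.knotClass :=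
    congrArg (fun r => r.1.1) h
  have h2 : p.1.2 + Γ.sigmaSq n = q.1.2 + Γ.sigmaSq n := congrArg (fun r => r.1.2) h
  refine Subtype.ext (Prod.ext ?_ (add_right_cancel h2))
  have h3 := congrArg (fun t => t.translate (-Γ.knotClass)) h1
  simpa [PlumbingGraph.Spinc.translate_translate, PlumbingGraph.Spinc.translate_zero] using h3

/-- The second entry of a pair changes by `Σ² ≠ 0`. -/
lemma SpincPair.next_ne (p : Γ.SpincPair n hn) : p.next ≠ p := fun h =>
  Γ.sigmaSq_ne_zero n hn (left_eq_add.1 (congrArg (fun r => r.1.2) h).symm)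

/-- Every characteristic class `K` in `t` extends to a characteristic class `L` of the surgery with
`Â(L) = i`. -/
lemma SpincPair.exists_extension (p : Γ.SpincPair n hn) {K : Γ.ambient.Char}
    (hK : K.toSpinc = p.1.1) :
    ∃ L : (Γ.surgery n hn).Char, restrict L = K ∧ phi L = p := by
  obtain ⟨L, h, h'⟩ := p.2
  obtain ⟨x, rfl⟩ := Quotient.exact (s := Γ.ambient.spincSetoid) (h.trans hK.symm)
  refine ⟨L.act fun v => v.elim 0 x, restrict_act_of_none_eq_zero L rfl, ?_⟩
  rw [phi_act_of_none_eq_zero _ rfl]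
  exact Subtype.ext (Prod.ext h h')

lemma toSpinc_eq_of_phi_eq {L : (Γ.surgery n hn).Char} {p : Γ.Component n hn s}
    (h : phi L = p.1) : L.toSpinc = s :=
  phiSurgery_bijective.1 ((congrArg SpincPair.toClass h).trans p.2)

/-- The cube `[L|_G, E ∖ {v₀}]` of `G`. -/
def restrictCube (c : (Γ.surgery n hn).Cube) : Γ.ambient.Cube :=
  ⟨restrict c.base, c.dirs.eraseNone⟩

lemma indicator_none (I : Finset (Option V)) :
    PlumbingGraph.indicator I none = if none ∈ I then 1 else 0 := rfl

lemma indicator_comp_some (I : Finset (Option V)) :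
    (fun v => PlumbingGraph.indicator I (some v)) = PlumbingGraph.indicator I.eraseNone := by
  funext v
  simp [PlumbingGraph.indicator]

/-- For cubes with the same `(t, i)` and without the direction `v₀`, being a face can be tested after
restriction to `G`: directions other than `v₀` do not change `Â`. -/
lemma restrictCube_le_iff {c c' : (Γ.surgery n hn).Cube} (hc : none ∉ c.dirs)
    (hphi : phi c.base = phi c'.base) (hc' : none ∉ c'.dirs) :
    restrictCube c ≤ restrictCube c' ↔ c ≤ c' := by
  constructor
  · rintro ⟨h, I, hI, e⟩
    have hx : PlumbingGraph.indicator (I.map Function.Embedding.some) none = 0 := by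
      simp [PlumbingGraph.indicator]
    refine ⟨fun v hv => ?_, I.map Function.Embedding.some, fun v hv => ?_, ?_⟩
    · cases v with
      | none => exact absurd hv hc'
      | some v => exact Finset.mem_eraseNone.1 (h (Finset.mem_eraseNone.2 hv))
    · obtain ⟨v, hv', rfl⟩ := Finset.mem_map.1 hv
      simpa [restrictCube] using hI hv'
    · refine char_ext ?_ ?_
      · rw [PlumbingGraph.Cube.vertex, restrict_act_of_none_eq_zero _ hx, indicator_comp_some,
          Finset.eraseNone_map_some]
        exact e
      · rw [PlumbingGraph.Cube.vertex]
        exact congrArg (fun p => p.1.2) (hphi.symm.trans (phi_act_of_none_eq_zero _ hx).symm)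
  · rintro ⟨h, I, hI, e⟩
    have hx : PlumbingGraph.indicator I none = 0 :=
      if_neg fun h => hc (Finset.mem_sdiff.1 (hI h)).1
    refine ⟨Finset.eraseNone.monotone h, I.eraseNone, fun v hv => ?_, ?_⟩
    · simpa [restrictCube] using hI (Finset.mem_eraseNone.1 hv)
    · change restrict c'.base = (restrict c.base).act _
      rw [e, PlumbingGraph.Cube.vertex, restrict_act_of_none_eq_zero _ hx, indicator_comp_some]

/-- The cubes `[L, E]` with `v₀ ∉ E`, `L|_G ∈ t` and `Â(L) = i` are the cubes of `G` in `t`. -/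
def bCubesIso (p : Γ.Component n hn s) : BCubes p ≃o Γ.ambient.CubeCat p.1.1.1 :=
  RelIso.ofSurjective
    (⟨⟨fun c => ⟨restrictCube c.1.1, congrArg (fun q => q.1.1) c.2.2⟩, by
      intro c c' h
      have h1 := congrArg (fun d => d.1.base) h
      have h2 := congrArg (fun d => d.1.dirs) h
      refine Subtype.ext (Subtype.ext (PlumbingGraph.Cube.ext (char_ext h1
        (congrArg (fun q => q.1.2) (c.2.2.trans c'.2.2.symm))) (Finset.ext fun v => ?_)))
      cases v with
      | none => exact iff_of_false c.2.1 c'.2.1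
      | some v => simpa [restrictCube] using Finset.ext_iff.1 h2 v⟩,
      fun {c c'} => restrictCube_le_iff c.2.1 (c.2.2.trans c'.2.2.symm) c'.2.1⟩ :
      BCubes p ↪o Γ.ambient.CubeCat p.1.1.1) (by
    rintro ⟨⟨K, E⟩, hK⟩
    obtain ⟨L, rfl, h⟩ := p.1.exists_extension hK
    refine ⟨⟨⟨⟨L, E.map Function.Embedding.some⟩, toSpinc_eq_of_phi_eq h⟩, by simp, h⟩,
      Subtype.ext (PlumbingGraph.Cube.ext rfl ?_)⟩
    exact Finset.eraseNone_map_some E)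

lemma le_of_erase_le {c c' : (Γ.surgery n hn).Cube} (hc : none ∈ c.dirs)
    (h : (⟨c.base, c.dirs.erase none⟩ : (Γ.surgery n hn).Cube) ≤ ⟨c'.base, c'.dirs.erase none⟩) :
    c ≤ c' := by
  obtain ⟨h, I, hI, e⟩ := h
  refine ⟨fun v hv => ?_, I, fun v hv => ?_, e⟩
  · by_cases h1 : v = none
    · exact h1 ▸ hc
    · exact Finset.mem_of_mem_erase (h (Finset.mem_erase.2 ⟨h1, hv⟩))
  · have h1 := Finset.mem_sdiff.1 (hI hv)
    have h2 := Finset.mem_erase.1 h1.1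
    exact Finset.mem_sdiff.2 ⟨h2.2, fun h3 => h1.2 (Finset.mem_erase.2 ⟨h2.1, h3⟩)⟩

lemma eq_of_erase_eq {E E' : Finset (Option V)} (h : none ∈ E) (h' : none ∈ E')
    (e : E.erase none = E'.erase none) : E = E' := by
  rw [← Finset.insert_erase h, e, Finset.insert_erase h']

lemma act_neg_act (L : (Γ.surgery n hn).Char) (x : Option V → ℤ) : (L.act x).act (-x) = L := by
  rw [PlumbingGraph.Char.act_act, add_neg_cancel, PlumbingGraph.Char.act_zero]

lemma act_act_neg (L : (Γ.surgery n hn).Char) (x : Option V → ℤ) : (L.act (-x)).act x = L := by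
  rw [PlumbingGraph.Char.act_act, neg_add_cancel, PlumbingGraph.Char.act_zero]

/-- Passing to the left face is an isomorphism of posets, with inverse `[L, E] ↦ [L, E ∪ {v₀}]`. -/
def leftFaceIso (p : Γ.Component n hn s) : TCubes p ≃o BCubes p :=
  RelIso.ofSurjective
    (⟨⟨leftFace p, fun c c' h => Subtype.ext (Subtype.ext (PlumbingGraph.Cube.ext
        (congrArg (fun d => d.1.1.base) h)
        (eq_of_erase_eq c.2.1 c'.2.1 (congrArg (fun d => d.1.1.dirs) h))))⟩,
      fun {c _} => ⟨le_of_erase_le c.2.1, fun h => (leftFace p).monotone h⟩⟩ :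
      TCubes p ↪o BCubes p)
    fun d => ⟨⟨⟨⟨d.1.1.base, insert none d.1.1.dirs⟩, d.1.2⟩, Finset.mem_insert_self _ _, d.2.2⟩,
      Subtype.ext (Subtype.ext (PlumbingGraph.Cube.ext rfl (Finset.erase_insert d.2.1)))⟩

/-- Passing to the right face is an isomorphism of posets, with inverse
`[L, E] ↦ [L - v₀, E ∪ {v₀}]`. -/
def rightFaceIso (p : Γ.Component n hn s) : TCubes p ≃o BCubes p.next :=
  RelIso.ofSurjective
    (⟨⟨rightFace p, fun c c' h => Subtype.ext (Subtype.ext (PlumbingGraph.Cube.ext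
        (by
          have h1 : c.1.1.base.act handleClass = c'.1.1.base.act handleClass :=
            congrArg (fun d => d.1.1.base) h
          rw [← act_neg_act c.1.1.base handleClass, h1, act_neg_act])
        (eq_of_erase_eq c.2.1 c'.2.1 (congrArg (fun d => d.1.1.dirs) h))))⟩,
      fun {c c'} => ⟨fun h => le_of_erase_le c.2.1 (by
        have h1 := act_le (c := (rightFace p c).1.1) (c' := (rightFace p c').1.1) h (-handleClass)
        change (⟨(c.1.1.base.act handleClass).act (-handleClass), _⟩ : (Γ.surgery n hn).Cube) ≤
          ⟨(c'.1.1.base.act handleClass).act (-handleClass), _⟩ at h1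
        rwa [act_neg_act, act_neg_act] at h1), fun h => (rightFace p).monotone h⟩⟩ :
      TCubes p ↪o BCubes p.next)
    fun d => by
      have h : phi (d.1.1.base.act (-handleClass)) = p.1 := by
        refine SpincPair.next_injective ?_
        rw [← phi_act_of_none_eq_one (x := handleClass) _ rfl, act_act_neg]
        exact d.2.2
      exact ⟨⟨⟨⟨d.1.1.base.act (-handleClass), insert none d.1.1.dirs⟩, toSpinc_eq_of_phi_eq h⟩,
        Finset.mem_insert_self _ _, h⟩, Subtype.ext (Subtype.ext (PlumbingGraph.Cube.ext
          (act_act_neg _ _) (Finset.erase_insert d.2.1)))⟩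

/-- The cubes `[L, E]` with `v₀ ∈ E`, `L|_G ∈ t` and `Â(L) = i` are the cubes of `G` in `t`. -/
def tCubesIso (p : Γ.Component n hn s) : TCubes p ≃o Γ.ambient.CubeCat p.1.1.1 :=
  (leftFaceIso p).trans (bCubesIso p)

/-! ### Heights of cubes -/

/-- The height of a vertex in terms of the restriction to `G`: it is `h_U + g(i)` on the side of the
left face and `h_V + g(i + Σ²)` on the side of the right face. -/
lemma height_act (L : (Γ.surgery n hn).Char) (x : Option V → ℤ) :
    (L.act x).height =
      (((restrict L).translate (x none • Γ.knotClass)).act fun v => x (some v)).height +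
        Γ.gradingShift n (alexanderHat L + x none * Γ.sigmaSq n) := by
  rw [height_eq, restrict_act, alexanderHat_act]

lemma height_vertex_of_notMem (c : (Γ.surgery n hn).Cube) {I : Finset (Option V)}
    (hI : none ∉ I) : (c.vertex I).height =
      ((restrictCube c).vertex I.eraseNone).height + Γ.gradingShift n (alexanderHat c.base) := by
  rw [PlumbingGraph.Cube.vertex, height_act, indicator_none, if_neg hI, zero_smul,
    PlumbingGraph.Char.translate_zero, indicator_comp_some]
  simp [restrictCube, PlumbingGraph.Cube.vertex]

lemma height_vertex_of_mem (c : (Γ.surgery n hn).Cube) {I : Finset (Option V)}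
    (hI : none ∈ I) : (c.vertex I).height =
      (PlumbingGraph.Cube.vertex
        ⟨(restrictCube c).base.translate Γ.knotClass, (restrictCube c).dirs⟩ I.eraseNone).height +
        (Γ.gradingShift n (alexanderHat c.base) + 2 * alexanderHat c.base) := by
  rw [PlumbingGraph.Cube.vertex, height_act, indicator_none, if_pos hI, one_smul,
    indicator_comp_some, gradingShift_add hn]
  simp [restrictCube, PlumbingGraph.Cube.vertex]

/-- The height is `h_U + g(i)` on cubes with `v₀ ∉ E`. -/
lemma le_height_iff_of_notMem {c : (Γ.surgery n hn).Cube} (hc : none ∉ c.dirs) (q : ℚ) :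
    q ≤ c.height ↔
      q - Γ.gradingShift n (alexanderHat c.base) ≤ (restrictCube c).height := by
  rw [PlumbingGraph.Cube.le_height_iff, PlumbingGraph.Cube.le_height_iff]
  constructor
  · intro h I hI
    have h1 := h (I.map Function.Embedding.some) fun v hv => by
      obtain ⟨v, hv', rfl⟩ := Finset.mem_map.1 hv
      exact Finset.mem_eraseNone.1 (hI hv')
    rw [height_vertex_of_notMem c (by simp), Finset.eraseNone_map_some] at h1
    linarith
  · intro h I hI
    have h1 := h I.eraseNone (Finset.eraseNone.monotone hI)
    rw [height_vertex_of_notMem c fun h2 => hc (hI h2)]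
    linarith

/-- The height is `min (h_U, h_V + 2i) + g(i)` on cubes with `v₀ ∈ E`. -/
lemma le_height_iff_of_mem {c : (Γ.surgery n hn).Cube} (hc : none ∈ c.dirs) (q : ℚ) :
    q ≤ c.height ↔
      q - Γ.gradingShift n (alexanderHat c.base) ≤ (restrictCube c).height ∧
      q - Γ.gradingShift n (alexanderHat c.base) - 2 * alexanderHat c.base ≤
        PlumbingGraph.Cube.height
          ⟨(restrictCube c).base.translate Γ.knotClass, (restrictCube c).dirs⟩ := by
  rw [PlumbingGraph.Cube.le_height_iff, PlumbingGraph.Cube.le_height_iff,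
    PlumbingGraph.Cube.le_height_iff]
  constructor
  · refine fun h => ⟨fun I hI => ?_, fun I hI => ?_⟩
    · have h1 := h (I.map Function.Embedding.some) fun v hv => by
        obtain ⟨v, hv', rfl⟩ := Finset.mem_map.1 hv
        exact Finset.mem_eraseNone.1 (hI hv')
      rw [height_vertex_of_notMem c (by simp), Finset.eraseNone_map_some] at h1
      linarith
    · have h1 := h (Finset.insertNone I) fun v hv => by
        cases v with
        | none => exact hc
        | some v => exact Finset.mem_eraseNone.1 (hI (Finset.some_mem_insertNone.1 hv))
      rw [height_vertex_of_mem c (by simp), Finset.eraseNone_insertNone] at h1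
      linarith
  · rintro ⟨h, h'⟩ I hI
    have hI' := Finset.eraseNone.monotone hI
    by_cases hI0 : none ∈ I
    · have h1 := h' I.eraseNone hI'
      rw [height_vertex_of_mem c hI0]
      linarith
    · have h1 := h I.eraseNone hI'
      rw [height_vertex_of_notMem c hI0]
      linarith

lemma Component.next_ne (p : Γ.Component n hn s) : p.next ≠ p := fun h =>
  SpincPair.next_ne p.1 (congrArg Subtype.val h)

instance : Quiver.IsThin (Γ.SpincDiagram n hn s) := ZigZag.isThin Component.next_ne

/-! ### The pieces and the surgery diagram -/

/-- The two heights of the cubes of `G` in `t`. -/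
abbrev biheight (t : Γ.ambient.Spinc) : Γ.ambient.CubeCat t →o
    BiLevel (Γ.ambient.grading t) (Γ.ambient.grading (Γ.addKnot t)) :=
  BiLevel.pair (Γ.ambient.heightU t) (Γ.heightV t)

/-- The height function on the cubes with `v₀ ∈ E`. -/
abbrev heightT (p : Γ.Component n hn s) : TCubes p →o Level ((Γ.surgery n hn).grading s) :=
  ((Γ.surgery n hn).heightU s).comp (OrderHom.Subtype.val _)

/-- The height function on the cubes with `v₀ ∉ E`. -/
abbrev heightB (p : Γ.Component n hn s) : BCubes p →o Level ((Γ.surgery n hn).grading s) :=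
  ((Γ.surgery n hn).heightU s).comp (OrderHom.Subtype.val _)

lemma alexanderHat_eq {L : (Γ.surgery n hn).Char} {p : Γ.Component n hn s} (h : phi L = p.1) :
    alexanderHat L = p.1.1.2 := congrArg (fun q => q.1.2) h

lemma le_heightB_iff (p : Γ.Component n hn s) (q : Level ((Γ.surgery n hn).grading s))
    (c : BCubes p) : q ≤ heightB p c ↔
      Level.sub (Γ.gradingShift n p.1.1.2) (SpincPair.shift_coset p.2) q ≤
        Γ.ambient.heightU p.1.1.1 (bCubesIso p c) := by
  have h := le_height_iff_of_notMem c.2.1 q.1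
  rwa [alexanderHat_eq c.2.2] at h

lemma restrictCube_erase_none (c : (Γ.surgery n hn).Cube) :
    restrictCube ⟨c.base, c.dirs.erase none⟩ = restrictCube c :=
  PlumbingGraph.Cube.ext rfl (Finset.ext fun v => by simp [restrictCube])

lemma tCubesIso_coe (p : Γ.Component n hn s) (c : TCubes p) :
    (tCubesIso p c).1 = restrictCube c.1.1 :=
  restrictCube_erase_none _

lemma le_heightT_iff (p : Γ.Component n hn s) (q : Level ((Γ.surgery n hn).grading s))
    (c : TCubes p) : q ≤ heightT p c ↔
      (alexanderHom p.1.1.2 (SpincPair.alexander_coset p.1)).comp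
          (Level.sub (Γ.gradingShift n p.1.1.2) (SpincPair.shift_coset p.2)) q ≤
        biheight p.1.1.1 (tCubesIso p c) := by
  have h := le_height_iff_of_mem c.2.1 q.1
  rw [alexanderHat_eq c.2.2, ← tCubesIso_coe p c] at h
  exact h

/-- The map `B_i(t) ⟶ p_{1,!}(CFK^t)[g(i)]`, with `p_{1,!}(CFK^t)` as the space with heights
`h_U`. -/
def bMap (p : Γ.Component n hn s) : BSpace p ⟶
    (Filt.shift (Γ.gradingShift n p.1.1.2) (SpincPair.shift_coset p.2)).obj
      (heightSpace (Γ.ambient.heightU p.1.1.1)) :=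
  heightPullMap (heightB p) _ _ ⟨bCubesIso p, (bCubesIso p).monotone⟩
    fun q c => (le_heightB_iff p q c).1

instance (p : Γ.Component n hn s) : IsIso (bMap p) :=
  isIso_heightPullMap (heightB p) _ _ (bCubesIso p) (le_heightB_iff p)

/-- The map `T_i(t) ⟶ A_i^*(CFK^t)[g(i)]`. -/
def tMap (p : Γ.Component n hn s) : TSpace p ⟶
    (Filt.shift (Γ.gradingShift n p.1.1.2) (SpincPair.shift_coset p.2)).obj
      ((Filt.alexander p.1.1.2 (SpincPair.alexander_coset p.1)).obj (Γ.CFKSpace p.1.1.1)) :=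
  heightPullMap (heightT p) (biheight p.1.1.1)
    ((alexanderHom p.1.1.2 (SpincPair.alexander_coset p.1)).comp
      (Level.sub (Γ.gradingShift n p.1.1.2) (SpincPair.shift_coset p.2))) ⟨tCubesIso p, (tCubesIso p).monotone⟩
    fun q c => (le_heightT_iff p q c).1

lemma isIso_tMap (p : Γ.Component n hn s) : IsIso (tMap p) :=
  isIso_heightPullMap (heightT p) (biheight p.1.1.1) _ (tCubesIso p) (le_heightT_iff p)

/-- The identification of `p_{1,!}(CFK^t)` with the space with heights `h_U`. -/
def p₁Iso (t : Γ.ambient.Spinc) :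
    Filt.p₁.obj (Γ.CFKSpace t) ≅ heightSpace (Γ.ambient.heightU t) :=
  pushIso (biheight t) BiLevel.fst

/-- The identification of `p_{2,!}(CFK^t)` with the space with heights `h_V`. -/
def p₂Iso (t : Γ.ambient.Spinc) :
    Filt.p₂.obj (Γ.CFKSpace t) ≅ heightSpace (Γ.heightV t) :=
  pushIso (biheight t) BiLevel.snd

lemma eta₁_comp_p₁Iso_hom (p : Γ.Component n hn s) :
    (Filt.eta₁ p.1.1.2 (SpincPair.alexander_coset p.1)).app (Γ.CFKSpace p.1.1.1) ≫
        (p₁Iso p.1.1.1).hom =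
      (Filt.alexander p.1.1.2 (SpincPair.alexander_coset p.1)).map
        (heightUnit (biheight p.1.1.1) BiLevel.fst) :=
  congrArg (Filt.alexander p.1.1.2 (SpincPair.alexander_coset p.1)).map
    (pushUnit_comp_pushIso_hom (biheight p.1.1.1) BiLevel.fst)

lemma eta₂_comp_p₂Iso_hom (p : Γ.Component n hn s) :
    (Filt.eta₂ p.1.1.2 (SpincPair.alexander_coset p.1)).app (Γ.CFKSpace p.1.1.1) ≫
        (Filt.shift (2 * p.1.1.2) (SpincPair.alexander_coset p.1)).map (p₂Iso p.1.1.1).hom =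
      (Filt.alexander p.1.1.2 (SpincPair.alexander_coset p.1)).map
        (heightUnit (biheight p.1.1.1) BiLevel.snd) :=
  congrArg (Filt.alexander p.1.1.2 (SpincPair.alexander_coset p.1)).map
    (pushUnit_comp_pushIso_hom (biheight p.1.1.1) BiLevel.snd)

lemma flip_comp_p₁Iso_hom (t : Γ.ambient.Spinc) :
    Γ.flip t ≫ (p₁Iso (Γ.addKnot t)).hom = (p₂Iso t).hom ≫
      heightMap (Γ.heightV t) (Γ.ambient.heightU (Γ.addKnot t)) (Γ.translateCube t)
        (fun _ => le_refl _) := by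
  change ((p₂Iso t).hom ≫ heightMap _ _ _ _ ≫ (p₁Iso (Γ.addKnot t)).inv) ≫ _ = _
  rw [Category.assoc, Category.assoc, Iso.inv_hom_id, Category.comp_id]

/-- The isomorphism `B_i(t) ≅ p_{1,!}(CFK^t)[g(i)]`. -/
def bIso (p : Γ.Component n hn s) : BSpace p ≅
    (Filt.shift (Γ.gradingShift n p.1.1.2) (SpincPair.shift_coset p.2)).obj
      (Filt.p₁.obj (Γ.CFKSpace p.1.1.1)) :=
  asIso (bMap p) ≪≫ (Filt.shift _ (SpincPair.shift_coset p.2)).mapIso (p₁Iso p.1.1.1).symm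

lemma bIso_hom_comp (p : Γ.Component n hn s) :
    (bIso p).hom ≫ (Filt.shift _ (SpincPair.shift_coset p.2)).map (p₁Iso p.1.1.1).hom =
      bMap p := by
  rw [bIso, Iso.trans_hom, Category.assoc, Functor.mapIso_hom, ← Functor.map_comp, Iso.symm_hom,
    Iso.inv_hom_id, CategoryTheory.Functor.map_id, Category.comp_id, asIso_hom]

lemma lMap_comp_bIso_hom (p : Γ.Component n hn s) :
    lMap p ≫ (bIso p).hom = tMap p ≫
      (Filt.shift (Γ.gradingShift n p.1.1.2) (SpincPair.shift_coset p.2)).map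
        ((Filt.eta₁ p.1.1.2 (SpincPair.alexander_coset p.1)).app (Γ.CFKSpace p.1.1.1)) := by
  rw [← cancel_mono ((Filt.shift _ (SpincPair.shift_coset p.2)).map (p₁Iso p.1.1.1).hom),
    Category.assoc, Category.assoc, bIso_hom_comp, ← Functor.map_comp, eta₁_comp_p₁Iso_hom]
  ext q m z
  exact HeightSimplex.ext (h := Γ.ambient.heightU p.1.1.1) fun k => rfl

/-- The restriction of `L + v₀` to `G` is `L|_G + v₀`. -/
lemma bCubesIso_rightFace (p : Γ.Component n hn s) (c : TCubes p) :
    bCubesIso p.next (rightFace p c) = Γ.translateCube p.1.1.1 (tCubesIso p c) := by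
  refine Subtype.ext (PlumbingGraph.Cube.ext ?_ rfl)
  change restrict (c.1.1.base.act handleClass) = (restrict c.1.1.base).translate Γ.knotClass
  rw [restrict_act]
  simp only [handleClass, Option.elim, one_smul]
  exact PlumbingGraph.Char.act_zero _

/-- Naturality of the identification `X[r][q] = X[q + r]`, in the form in which it occurs after `ρ`. -/
lemma comp_shift_map_comp_shiftShift_app {q r q' : ℚ} (e : q + r = q') {c c' c'' : GradingCoset}
    (h : c + (r : GradingCoset) = c') (h' : c' + (q : GradingCoset) = c'')
    (h'' : c + (q' : GradingCoset) = c'') {x : Filt (Level c'')} {y : Filt (Level c')}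
    {z z' : Filt (Level c)} (a : x ⟶ (Filt.shift q h').obj y) (b : y ⟶ (Filt.shift r h).obj z)
    (f : z ⟶ z') :
    (a ≫ (Filt.shift q h').map b ≫ (Filt.shiftShift e h h' h'').app z) ≫
        (Filt.shift q' h'').map f =
      a ≫ (Filt.shift q h').map (b ≫ (Filt.shift r h).map f) ≫
        (Filt.shiftShift e h h' h'').app z' := by
  have hn := (Filt.shiftShift e h h' h'').naturality f
  rw [Functor.map_comp, Category.assoc, Category.assoc, Category.assoc, ← hn]
  rfl

lemma eta₂_comp_flip_comp_p₁Iso_hom (p : Γ.Component n hn s) :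
    ((Filt.eta₂ p.1.1.2 (SpincPair.alexander_coset p.1)).app (Γ.CFKSpace p.1.1.1) ≫
        (Filt.shift (2 * p.1.1.2) (SpincPair.alexander_coset p.1)).map (Γ.flip p.1.1.1)) ≫
        (Filt.shift (2 * p.1.1.2) (SpincPair.alexander_coset p.1)).map
          (p₁Iso (Γ.addKnot p.1.1.1)).hom =
      (Filt.alexander p.1.1.2 (SpincPair.alexander_coset p.1)).map
          (heightUnit (biheight p.1.1.1) BiLevel.snd) ≫
        (Filt.shift (2 * p.1.1.2) (SpincPair.alexander_coset p.1)).map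
          (heightMap (Γ.heightV p.1.1.1) (Γ.ambient.heightU (Γ.addKnot p.1.1.1))
            (Γ.translateCube p.1.1.1) (fun _ => le_refl _)) := by
  rw [Category.assoc, ← Functor.map_comp, flip_comp_p₁Iso_hom, Functor.map_comp,
    ← Category.assoc, eta₂_comp_p₂Iso_hom]
  rfl

lemma rMap_comp_bIso_hom (p : Γ.Component n hn s) :
    rMap p ≫ (bIso p.next).hom = tMap p ≫
      (Filt.shift (Γ.gradingShift n p.1.1.2) (SpincPair.shift_coset p.2)).map
        ((Filt.eta₂ p.1.1.2 (SpincPair.alexander_coset p.1)).app (Γ.CFKSpace p.1.1.1) ≫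
          (Filt.shift (2 * p.1.1.2) (SpincPair.alexander_coset p.1)).map (Γ.flip p.1.1.1)) ≫
      (Filt.shiftShift (gradingShift_add hn p.1.1.2)
        (SpincPair.alexander_coset p.1) (SpincPair.shift_coset p.2)
        (SpincPair.shift_coset (p := p.next.1) p.next.2)).app
          (Filt.p₁.obj (Γ.CFKSpace (Γ.addKnot p.1.1.1))) := by
  -- Both sides are compared in the space with heights `h_U`, where they are explicit on chains.
  refine (cancel_mono
    ((Filt.shift _ (SpincPair.shift_coset p.next.2)).map (p₁Iso p.next.1.1.1).hom)).1 ?_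
  refine ((Category.assoc _ _ _).trans (congrArg (rMap p ≫ ·) (bIso_hom_comp p.next))).trans ?_
  have h := comp_shift_map_comp_shiftShift_app (gradingShift_add hn p.1.1.2)
    (SpincPair.alexander_coset p.1) (SpincPair.shift_coset p.2)
    (SpincPair.shift_coset (p := p.next.1) p.next.2) (tMap p)
    ((Filt.eta₂ p.1.1.2 (SpincPair.alexander_coset p.1)).app (Γ.CFKSpace p.1.1.1) ≫
      (Filt.shift (2 * p.1.1.2) (SpincPair.alexander_coset p.1)).map (Γ.flip p.1.1.1))
    (p₁Iso (Γ.addKnot p.1.1.1)).hom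
  rw [eta₂_comp_flip_comp_p₁Iso_hom] at h
  refine Eq.trans ?_ h.symm
  ext q m z
  exact HeightSimplex.ext (h := Γ.ambient.heightU p.next.1.1.1) fun k =>
    bCubesIso_rightFace p _

variable (n hn s) in
/-- The diagram of the pieces `T_i(t)`, `B_i(t)` is the surgery diagram of the knot lattice space. -/
def tbIsoXD : Γ.TB n hn s ≅ Γ.XD n hn s Γ.CFK :=
  ZigZag.diagramIso (fun p => @asIso _ _ _ _ (tMap p) (isIso_tMap p)) bIso lMap_comp_bIso_hom rMap_comp_bIso_hom

/-! ### Decomposition of the poset of cubes -/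

/-- The piece of the poset of cubes of `G_{v₀}(n)` over an object of the indexing category of the
surgery diagram. -/
def CubePiece : Γ.SpincDiagram n hn s → Type
  | .a p => TCubes p
  | .b p => BCubes p

instance : ∀ X : Γ.SpincDiagram n hn s, Preorder (CubePiece X)
  | .a p => inferInstanceAs (Preorder (TCubes p))
  | .b p => inferInstanceAs (Preorder (BCubes p))

/-- The inclusion of a piece in the poset of cubes. -/
def CubePiece.incl : ∀ X : Γ.SpincDiagram n hn s, CubePiece X →o (Γ.surgery n hn).CubeCat s
  | .a p => (OrderHom.Subtype.val _ : TCubes p →o _)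
  | .b p => (OrderHom.Subtype.val _ : BCubes p →o _)

/-- The isomorphism of pieces given by passing to the left or to the right face. -/
def CubePiece.tr : ∀ {X Y : Γ.SpincDiagram n hn s}, ZigZag.Hom X Y → (CubePiece X ≃o CubePiece Y)
  | _, _, .id _ => OrderIso.refl _
  | _, _, .lam p => leftFaceIso p
  | _, _, .rho p => rightFaceIso p

/-- The object of the indexing category over which a cube lies. -/
def cubeIndex (c : (Γ.surgery n hn).CubeCat s) : Γ.SpincDiagram n hn s :=
  if none ∈ c.1.dirs then .a ⟨phi c.1.base, congrArg phiSurgery c.2⟩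
  else .b ⟨phi c.1.base, congrArg phiSurgery c.2⟩

lemma CubePiece.cubeIndex_incl (X : Γ.SpincDiagram n hn s) (d : CubePiece X) :
    cubeIndex (CubePiece.incl X d) = X := by
  cases X with
  | a p => exact (if_pos d.2.1).trans (congrArg ZigZag.a (Subtype.ext d.2.2))
  | b p => exact (if_neg d.2.1).trans (congrArg ZigZag.b (Subtype.ext d.2.2))

lemma phi_vertex_of_notMem (c : (Γ.surgery n hn).Cube) {I : Finset (Option V)} (hI : none ∉ I) :
    phi (c.vertex I) = phi c.base :=
  phi_act_of_none_eq_zero _ (if_neg hI)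

lemma phi_vertex_of_mem (c : (Γ.surgery n hn).Cube) {I : Finset (Option V)} (hI : none ∈ I) :
    phi (c.vertex I) = (phi c.base).next :=
  phi_act_of_none_eq_one _ (if_pos hI)

/-- The pair `(t, i)` is the same for a cube and for a face with the same extent in direction `v₀`. -/
lemma phi_eq_of_le {c c' : (Γ.surgery n hn).Cube} (h : c ≤ c')
    (hc : none ∈ c.dirs → none ∈ c'.dirs) : phi c'.base = phi c.base := by
  obtain ⟨h, I, hI, e⟩ := h
  rw [e, phi_vertex_of_notMem c fun h1 => (Finset.mem_sdiff.1 (hI h1)).2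
    (hc (Finset.mem_sdiff.1 (hI h1)).1)]

/-- A face `c'` of `c` that does not contain the direction `v₀` is a face of the left face or of the
right face of `c`. -/
lemma left_or_right_le {c c' : (Γ.surgery n hn).Cube} (h : c ≤ c')
    (hc' : none ∉ c'.dirs) :
    phi c'.base = phi c.base ∧
        (⟨c.base, c.dirs.erase none⟩ : (Γ.surgery n hn).Cube) ≤ c' ∨
      phi c'.base = (phi c.base).next ∧
        (⟨c.base.act handleClass, c.dirs.erase none⟩ : (Γ.surgery n hn).Cube) ≤ c' := by
  obtain ⟨h, I, hI, e⟩ := h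
  have hE : c'.dirs ⊆ c.dirs.erase none := Finset.subset_erase.2 ⟨h, hc'⟩
  by_cases hI0 : none ∈ I
  · refine .inr ⟨e ▸ phi_vertex_of_mem c hI0, hE, I.erase none, fun v hv => ?_, ?_⟩
    · have h1 := Finset.mem_erase.1 hv
      have h2 := Finset.mem_sdiff.1 (hI h1.2)
      exact Finset.mem_sdiff.2 ⟨Finset.mem_erase.2 ⟨h1.1, h2.1⟩, h2.2⟩
    · rw [e, PlumbingGraph.Cube.vertex, PlumbingGraph.Cube.vertex, PlumbingGraph.Char.act_act]
      congr 1
      funext v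
      cases v <;> simp [PlumbingGraph.indicator, handleClass, hI0]
  · refine .inl ⟨e ▸ phi_vertex_of_notMem c hI0, hE, I, fun v hv => ?_, e⟩
    have h2 := Finset.mem_sdiff.1 (hI hv)
    exact Finset.mem_sdiff.2 ⟨Finset.mem_erase.2 ⟨fun h3 => hI0 (h3 ▸ hv), h2.1⟩, h2.2⟩

variable (n hn s) in
/-- The cubes of `G_{v₀}(n)` in the `Spin^c` structure `s`, decomposed over the indexing category of
the surgery diagram. -/
def cubeFibration : PosetFibration (Γ.SpincDiagram n hn s) ((Γ.surgery n hn).CubeCat s) where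
  D := CubePiece
  tr := CubePiece.tr
  tr_id _ := rfl
  tr_comp f g d := by
    change ZigZag.Hom _ _ at f g
    cases f <;> cases g <;> rfl
  ι := CubePiece.incl
  ι_injective
    | .a _ => Subtype.val_injective
    | .b _ => Subtype.val_injective
  exists_ι_eq c := by
    let p : Γ.Component n hn s := ⟨phi c.1.base, congrArg phiSurgery c.2⟩
    by_cases h : none ∈ c.1.dirs
    · exact ⟨.a p, ⟨c, h, rfl⟩, rfl⟩
    · exact ⟨.b p, ⟨c, h, rfl⟩, rfl⟩
  index_eq {i j d d'} e := by
    rw [← CubePiece.cubeIndex_incl i d, e, CubePiece.cubeIndex_incl]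
  le_tr {i j} f d := by
    change ZigZag.Hom _ _ at f
    cases f with
    | id => exact le_refl _
    | lam p => exact le_erase _
    | rho p => exact le_act_erase (show TCubes p from d).2.1
  exists_tr_le {i j d d'} h := by
    cases i with
    | a p =>
      obtain ⟨c, hc, hp⟩ := d
      cases j with
      | a q =>
        obtain ⟨c', hc', hq⟩ := d'
        obtain rfl : q = p := Subtype.ext (hq.symm.trans ((phi_eq_of_le h fun _ => hc').trans hp))
        exact ⟨𝟙 _, h⟩
      | b q =>
        obtain ⟨c', hc', hq⟩ := d'
        obtain ⟨e, h1⟩ | ⟨e, h1⟩ := left_or_right_le h hc'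
        · obtain rfl : q = p := Subtype.ext (hq.symm.trans (e.trans hp))
          exact ⟨ZigZag.Hom.lam q, h1⟩
        · obtain rfl : q = p.next :=
            Subtype.ext (hq.symm.trans (e.trans (congrArg SpincPair.next hp)))
          exact ⟨ZigZag.Hom.rho p, h1⟩
    | b p =>
      obtain ⟨c, hc, hp⟩ := d
      cases j with
      | a q =>
        obtain ⟨c', hc', hq⟩ := d'
        exact absurd (h.1 hc') hc
      | b q =>
        obtain ⟨c', hc', hq⟩ := d'
        obtain rfl : q = p :=
          Subtype.ext (hq.symm.trans ((phi_eq_of_le h fun h2 => absurd h2 hc).trans hp))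
        exact ⟨𝟙 _, h⟩

variable (n hn s) in
/-- The diagram of the `T_i(t)` and `B_i(t)` is the diagram of the pieces of the lattice space. -/
def tbIsoPieces :
    Γ.TB n hn s ≅ (cubeFibration n hn s).pieces ((Γ.surgery n hn).heightU s) :=
  NatIso.ofComponents (fun | .a p => Iso.refl (TSpace p) | .b p => Iso.refl (BSpace p)) (by
    intro X Y f
    change ZigZag.Hom _ _ at f
    cases f with
    | id X => cases X <;> rfl
    | lam p => rfl
    | rho p => rfl)

end KnotGraph

end Plumbing

theorem proposition6p1 {V : Type} [Fintype V] [DecidableEq V] (Γ : KnotGraph V) (n : ℤ)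
    (hn : IsNegDef (Γ.framedForm n)) :
    (∀ s : (Γ.surgery n hn).Spinc, Nonempty (Γ.TB n hn s ≅ Γ.XD n hn s Γ.CFK)) ∧
      Nonempty (Γ.Xb n hn Γ.CFK ≅ (Γ.surgery n hn).CF) := by
  refine ⟨fun s => ⟨KnotGraph.tbIsoXD n hn s⟩, ⟨Pi.isoMk fun s => ?_⟩⟩
  exact Filt.hocolimIso ((KnotGraph.tbIsoXD n hn s).symm ≪≫ KnotGraph.tbIsoPieces n hn s) ≪≫
    (KnotGraph.cubeFibration n hn s).totalIso ((Γ.surgery n hn).heightU s)
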